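/- Let $G$ be a group. (a) There is a CW-complex $X_G$ of dimension $2$ (it has at least one $2$-cell and no cells of dimension greater than $2$) which is path connected and satisfies $\pi_1(X_G,x)\cong G$ for every base point $x\in X_G$. (b) The complex can be built from any presentation of $G$, as follows. Let $(g_\alpha)_{\alpha\in A}$ be a family of letters and $(r_\beta)_{\beta\in B}$ a family of words in the $g_\alpha$ and their formal inverses such that $G\cong\langle g_\alpha\mid r_\beta\rangle$, i.e. $G$ is isomorphic to the quotient of the free group on $A$ by the normal closure of the elements represented by the $r_\beta$ (every group has such a presentation, and it can be chosen with $B\neq\emptyset$). Let $\bigvee_{\alpha\in A}S^1$ be the wedge of one circle for each generator (a point if $A=\emptyset$). Each word $r_\beta$ defines a loop in the wedge at the wedge point: run, letter by letter, once around the circle of index $\alpha$ in the positive direction for each letter $g_\alpha$ and in the negative direction for each letter $g_\alpha^{-1}$ (the constant loop if the word is empty). Let $$X=\Bigl(\bigvee_{\alpha\in A}S^1\Bigr)\cup\coprod_{\beta\in B}D^2$$ be the space obtained by attaching one disc for each $\beta\in B$ along the loop of $r_\beta$. Then $X$ is a CW-complex with exactly one $0$-cell (the wedge point), with the circles, indexed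 by $A$, as $1$-cells, with the attached discs, indexed by $B$, as $2$-cells, and with no cells of dimension greater than $2$; its $1$-skeleton is the wedge of circles $\bigvee_{\alpha\in A}S^1$. Moreover $X$ is path connected and $\pi_1(X,x)\cong G$ for every base point $x\in X$. -/

import Mathlib

universe u

noncomputable section

open CategoryTheory

/-! ### Cells, characteristic maps and skeleta of a CW-complex -/

namespace TopCat.CWComplex

/-- The index type of the `n`-cells of a CW-complex. -/
def CellIndex {X : TopCat.{u}} (c : TopCat.CWComplex X) (n : ℕ) : Type u :=
  (c.attachCells n (not_isMax n)).ι

/-- The characteristic map `𝔻 n → X` of an `n`-cell. -/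
def charMap {X : TopCat.{u}} (c : TopCat.CWComplex X) (n : ℕ) (k : c.CellIndex n) :
    TopCat.disk.{u} n ⟶ X :=
  HomotopicalAlgebra.RelativeCellComplex.Cells.ι (c := c)
    { j := n, hj := not_isMax n, k := k }

/-- The `n`-skeleton of a CW-complex: the stage reached once the cells of dimension `0, …, n`
have been attached (stage `0` is the empty space). -/
def skel {X : TopCat.{u}} (c : TopCat.CWComplex X) (n : ℕ) : TopCat.{u} :=
  c.F.obj (n + 1)

/-- The inclusion of the `n`-skeleton. -/
def skelIncl {X : TopCat.{u}} (c : TopCat.CWComplex X) (n : ℕ) : c.skel n ⟶ X :=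
  c.incl.app (n + 1)

/-- The CW-complex has dimension exactly `n`: there is an `n`-cell and there are no cells of
higher dimension. -/
def HasDimension {X : TopCat.{u}} (c : TopCat.CWComplex X) (n : ℕ) : Prop :=
  Nonempty (c.CellIndex n) ∧ ∀ m, n < m → IsEmpty (c.CellIndex m)

end TopCat.CWComplex

/-! ### Wedges of circles -/

/-- The relation on `{pt} ⊔ ∐_α S¹` that identifies the base point of each circle with `pt`. -/
inductive CircleWedge.Rel (α : Type u) : Unit ⊕ (Σ _ : α, Circle) → Unit ⊕ (Σ _ : α, Circle) → Prop
  | glue (a : α) : CircleWedge.Rel α (Sum.inr ⟨a, 1⟩) (Sum.inl ())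

/-- The wedge of a family of circles indexed by `α`, with the quotient topology
(a point if `α` is empty). -/
def CircleWedge (α : Type u) : Type u := Quot (CircleWedge.Rel α)

namespace CircleWedge

variable {α : Type u}

instance : TopologicalSpace (CircleWedge α) :=
  inferInstanceAs (TopologicalSpace (Quot (CircleWedge.Rel α)))

/-- The wedge point. -/
def base : CircleWedge α := Quot.mk _ (Sum.inl ())

/-- The inclusion of the circle with index `a`. -/
def circle (a : α) (z : Circle) : CircleWedge α := Quot.mk _ (Sum.inr ⟨a, z⟩)

theorem circle_one (a : α) : circle a 1 = base := Quot.sound (Rel.glue a)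

theorem continuous_circle (a : α) : Continuous (circle a) :=
  continuous_quot_mk.comp (continuous_inr.comp continuous_sigmaMk)

/-- The loop that runs once, counterclockwise, around the circle with index `a`. -/
def loop (a : α) : Path (base : CircleWedge α) base where
  toFun t := circle a (Circle.exp (2 * Real.pi * t))
  continuous_toFun := (continuous_circle a).comp (by fun_prop)
  source' := by simp [circle_one]
  target' := by simp [circle_one]

/-- The loop of a letter: `(a, true)` stands for the generator `a` and `(a, false)` for its
inverse. -/
def letterLoop (x : α × Bool) : Path (base : CircleWedge α) base :=
  if x.2 then loop x.1 else (loop x.1).symm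

/-- The loop of a word: the loops of its letters, run through one after the other. -/
def wordLoop : List (α × Bool) → Path (base : CircleWedge α) base
  | [] => Path.refl base
  | x :: l => (letterLoop x).trans (wordLoop l)

end CircleWedge

/-! ### Presentation complexes -/

/-- The words `w i` in the letters `α ⊔ α⁻¹` are the relators of a presentation, with
generators `α`, of the group `G`. -/
def Presents {α ι : Type u} (w : ι → List (α × Bool)) (G : Type u) [Group G] : Prop :=
  Nonempty (PresentedGroup (Set.range fun i => FreeGroup.mk (w i)) ≃* G)

/-- The closed unit disc in the Euclidean plane. -/
abbrev ClosedDisc : Type := Metric.closedBall (0 : EuclideanSpace ℝ (Fin 2)) 1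

/-- The point `(cos 2πt, sin 2πt)` of the boundary of the disc. -/
def boundaryPoint (t : unitInterval) : ClosedDisc :=
  ⟨!₂[Real.cos (2 * Real.pi * t), Real.sin (2 * Real.pi * t)], by
    simp [EuclideanSpace.norm_eq, Fin.sum_univ_two]⟩

/-- The relation on `(⋁_α S¹) ⊔ ∐_ι D²` that identifies each boundary point
`(cos 2πt, sin 2πt)` of the disc with index `i` with the value at `t` of the loop of `w i`. -/
inductive PresentationComplex.Rel {α ι : Type u} (w : ι → List (α × Bool)) :
    CircleWedge α ⊕ (Σ _ : ι, ClosedDisc) → CircleWedge α ⊕ (Σ _ : ι, ClosedDisc) → Prop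
  | glue (i : ι) (t : unitInterval) : PresentationComplex.Rel w
      (Sum.inr ⟨i, boundaryPoint t⟩) (Sum.inl (CircleWedge.wordLoop (w i) t))

/-- The presentation complex: a wedge of circles, one for each generator, with discs attached
along the relators. -/
def PresentationComplex {α ι : Type u} (w : ι → List (α × Bool)) : Type u :=
  Quot (PresentationComplex.Rel w)

namespace PresentationComplex

variable {α ι : Type u} (w : ι → List (α × Bool))

instance : TopologicalSpace (PresentationComplex w) :=
  inferInstanceAs (TopologicalSpace (Quot (PresentationComplex.Rel w)))

/-- The map from the wedge of circles to the presentation complex. -/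
def ofWedge (x : CircleWedge α) : PresentationComplex w := Quot.mk _ (Sum.inl x)

/-- The map from the disc with index `i` to the presentation complex. -/
def ofDisc (i : ι) (x : ClosedDisc) : PresentationComplex w := Quot.mk _ (Sum.inr ⟨i, x⟩)

/-- The CW-structure `c` on the presentation complex is the expected one: the wedge point is the
only `0`-cell, the `1`-cells are the circles of the wedge, the `2`-cells are the attached discs,
there are no further cells, and the `1`-skeleton is the wedge of circles.
The characteristic map of a `1`-cell is the parametrization `x ↦ exp(πi(x + 1))`,
`-1 ≤ x ≤ 1`, of its circle. -/
def IsStandardCW (c : TopCat.CWComplex (TopCat.of (PresentationComplex w))) : Prop :=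
  Nonempty (c.CellIndex 0 ≃ Unit) ∧
  (∀ k x, c.charMap 0 k x = ofWedge w CircleWedge.base) ∧
  (∃ e₁ : c.CellIndex 1 ≃ α, ∀ k x, c.charMap 1 k x =
    ofWedge w (CircleWedge.circle (e₁ k) (Circle.exp (Real.pi * (x.down.1 0 + 1))))) ∧
  (∃ e₂ : c.CellIndex 2 ≃ ι, ∀ k x, c.charMap 2 k x = ofDisc w (e₂ k) x.down) ∧
  (∀ n, 2 < n → IsEmpty (c.CellIndex n)) ∧
  (∃ h : c.skel 1 ≃ₜ CircleWedge α, ∀ x, c.skelIncl 1 x = ofWedge w (h x))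

end PresentationComplex

end

/-!
A transport function assigns to each path of `X` an element of a group `H`. It is flat if along
every square it is the coboundary of an `H`-valued function; it is then multiplicative and homotopy
invariant, so it induces a homomorphism from `π₁`. Since this condition is local, flat transport
functions glue along open covers, which plays the role of van Kampen's theorem, with no condition
on the intersections. If `X` arises from `A` by attaching discs, a collar of `A` together with the
open discs is such a cover: a flat transport function on `A` extends to `X` as soon as it has
trivial holonomy along the attaching maps.

On the presentation complex, every family of elements of `H` satisfying the relations is thus the
holonomy of a flat transport function along the generators. With values in the presented group this
gives a left inverse of the homomorphism from the presented group to `π₁`. For surjectivity, let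
`π₁` act on its cosets modulo the image `K` of the presented group: the coset `K` is fixed by the
generators, hence extends to a parallel section over the complex, hence is fixed by all of `π₁`.
-/

open CategoryTheory Topology unitInterval

noncomputable section

/-! ### Flat transport -/

instance contractibleSpace_unitInterval : ContractibleSpace I :=
  (convex_Icc (0 : ℝ) 1).contractibleSpace ⟨0, unitInterval.zero_mem⟩

section FlatTransport

variable {X Y T H Q : Type*} [TopologicalSpace X] [TopologicalSpace Y] [TopologicalSpace T]
  [Group H] [MulAction H Q]

/-- Given a transport function `F`, which assigns to each path of `X` an element of `H`, the
function `U` on `T` is parallel along `g : T → X` if `F` carries its value at the start of each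
path of `T` to its value at the end. -/
def IsParallelAlong (F : C(I, X) → H) (g : C(T, X)) (U : T → Q) : Prop :=
  ∀ p : C(I, T), F (g.comp p) • U (p 0) = U (p 1)

/-- A transport function is flat if along every square there is a parallel `H`-valued function:
its value on a path is then multiplicative and depends only on the homotopy class. -/
def IsFlatTransport (F : C(I, X) → H) : Prop :=
  ∀ K : C(I × I, X), ∃ f : I × I → H, IsParallelAlong F K f

theorem IsParallelAlong.comp {F : C(I, X) → H} {g : C(T, X)} {U : T → Q}
    (hU : IsParallelAlong F g U) (k : C(Y, T)) : IsParallelAlong F (g.comp k) (U ∘ k) :=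
  fun p => hU (k.comp p)

theorem IsParallelAlong.smul_eq {F : C(I, X) → H} {g : C(T, X)} {U : T → Q}
    (hU : IsParallelAlong F g U) {γ : C(I, X)} (p : C(I, T)) (h : ∀ t, g (p t) = γ t) :
    F γ • U (p 0) = U (p 1) := by
  rw [show γ = g.comp p from ContinuousMap.ext fun t => (h t).symm, hU p]

theorem isFlatTransport_coboundary (f : X → H) :
    IsFlatTransport fun γ : C(I, X) => f (γ 1) * (f (γ 0))⁻¹ :=
  fun K => ⟨f ∘ K, fun p => by simp⟩

theorem isFlatTransport_of_map_trans {F : C(I, X) → H}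
    (h_trans : ∀ {x y z : X} (γ : Path x y) (γ' : Path y z), F (γ.trans γ') = F γ' * F γ)
    (h_homotopic : ∀ {x y : X} {γ γ' : Path x y}, γ.Homotopic γ' → F γ = F γ') :
    IsFlatTransport F := by
  intro K
  let ray (z : I × I) : Path 0 z := PathConnectedSpace.somePath 0 z
  refine ⟨fun z => F ((ray z).map K.continuous), fun p => ?_⟩
  let side : Path (p 0) (p 1) := ⟨p, rfl, rfl⟩
  have h := (SimplyConnectedSpace.paths_homotopic ((ray (p 0)).trans side) (ray (p 1))).map K
  calc F (K.comp p) * F ((ray (p 0)).map K.continuous)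
      = F (((ray (p 0)).map K.continuous).trans (side.map K.continuous)) :=
        (h_trans ((ray (p 0)).map K.continuous) (side.map K.continuous)).symm
    _ = F (((ray (p 0)).trans side).map K.continuous) := by rw [Path.map_trans]
    _ = F ((ray (p 1)).map K.continuous) := h_homotopic h

namespace IsFlatTransport

variable {F : C(I, X) → H} (hF : IsFlatTransport F)
include hF

theorem comp (g : C(Y, X)) : IsFlatTransport fun γ : C(I, Y) => F (g.comp γ) :=
  fun K => hF (g.comp K)

theorem map_const (x : X) : F (.const I x) = 1 := by
  obtain ⟨f, hf⟩ := hF (.const _ x)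
  simpa using hf (.const I (0, 0))

theorem map_square (K : C(I × I, X)) {bottom top left right : C(I, X)}
    (h_bottom : ∀ t, K (t, 0) = bottom t) (h_top : ∀ t, K (t, 1) = top t)
    (h_left : ∀ s, K (0, s) = left s) (h_right : ∀ s, K (1, s) = right s) :
    F right * F bottom = F top * F left := by
  obtain ⟨f, hf⟩ := hF K
  have along_bottom : F bottom • f (0, 0) = f (1, 0) :=
    hf.smul_eq ⟨fun t => (t, 0), by fun_prop⟩ h_bottom
  have along_top : F top • f (0, 1) = f (1, 1) := hf.smul_eq ⟨fun t => (t, 1), by fun_prop⟩ h_top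
  have along_left : F left • f (0, 0) = f (0, 1) :=
    hf.smul_eq ⟨fun s => (0, s), by fun_prop⟩ h_left
  have along_right : F right • f (1, 0) = f (1, 1) :=
    hf.smul_eq ⟨fun s => (1, s), by fun_prop⟩ h_right
  rw [← along_bottom, ← along_top, ← along_left, smul_smul, smul_smul] at along_right
  exact mul_right_cancel along_right

theorem exists_isParallelAlong [ContractibleSpace Y] (g : C(Y, X)) (y₀ : Y) (q₀ : Q) :
    ∃ U : Y → Q, U y₀ = q₀ ∧ IsParallelAlong F g U := by
  obtain ⟨c, ⟨h⟩⟩ := id_nullhomotopic Y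
  let ray (y : Y) : C(I, X) := ⟨fun t => g (h (t, y)), by fun_prop⟩
  refine ⟨fun y => ((F (ray y))⁻¹ * F (ray y₀)) • q₀, by simp, fun p => ?_⟩
  have key : F (ray (p 1)) * F (g.comp p) = F (ray (p 0)) := by
    have h_square := hF.map_square ⟨fun z : I × I => g (h (z.2, p z.1)), by fun_prop⟩
      (bottom := g.comp p) (top := .const I (g c)) (left := ray (p 0)) (right := ray (p 1))
      (by simp) (by simp) (fun _ => rfl) (fun _ => rfl)
    rwa [hF.map_const, one_mul] at h_square
  rw [smul_smul, ← mul_assoc, ← key, mul_inv_rev, mul_inv_cancel_left]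

theorem map_trans {x y z : X} (γ : Path x y) (γ' : Path y z) :
    F (γ.trans γ') = F γ' * F γ := by
  obtain ⟨f, hf₀, hf⟩ := hF.exists_isParallelAlong (γ.trans γ').toContinuousMap 0 (1 : H)
  let firstHalf : C(I, I) :=
    ⟨fun t => ⟨t / 2, by linarith [t.2.1], by linarith [t.2.2]⟩, by fun_prop⟩
  let secondHalf : C(I, I) :=
    ⟨fun t => ⟨(1 + t) / 2, by linarith [t.2.1], by linarith [t.2.2]⟩, by fun_prop⟩
  have first : F γ • f (firstHalf 0) = f (firstHalf 1) := hf.smul_eq firstHalf fun t => by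
    have ht : (t / 2 : ℝ) ≤ 2⁻¹ := by linarith [t.2.2]
    simp [Path.trans_apply, firstHalf, ht, mul_div_cancel₀]
  have second : F γ' • f (secondHalf 0) = f (secondHalf 1) := hf.smul_eq secondHalf fun t => by
    rcases eq_or_ne t 0 with rfl | ht
    · simp [Path.trans_apply, secondHalf]
    · have ht' : ¬ ((1 + t) / 2 : ℝ) ≤ 2⁻¹ := by
        linarith [show (0 : ℝ) < t from unitInterval.pos_iff_ne_zero.mpr ht]
      simp [Path.trans_apply, secondHalf, ht', mul_div_cancel₀]
  have whole : F (γ.trans γ') • f 0 = f 1 := hf (.id I)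
  have start : firstHalf 0 = 0 := by ext; simp [firstHalf]
  have middle : secondHalf 0 = firstHalf 1 := by ext; simp [firstHalf, secondHalf]
  have finish : secondHalf 1 = 1 := by ext; norm_num [secondHalf]
  rw [middle, finish, ← first, start, ← whole, hf₀] at second
  simpa using second.symm

theorem map_symm {x y : X} (γ : Path x y) : F γ.symm = (F γ)⁻¹ := by
  obtain ⟨f, hf₀, hf⟩ := hF.exists_isParallelAlong γ.toContinuousMap 0 (1 : H)
  have forward : F γ • f 0 = f 1 := hf (.id I)
  have backward : F γ.symm • f 1 = f 0 := by
    have h := hf.smul_eq (γ := γ.symm) ⟨σ, by fun_prop⟩ fun t => (γ.symm_apply t).symm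
    rwa [ContinuousMap.coe_mk, symm_zero, symm_one] at h
  rw [← forward, hf₀, smul_smul, smul_eq_mul, mul_one] at backward
  exact eq_inv_of_mul_eq_one_left backward

theorem map_eq_of_homotopic {x y : X} {γ γ' : Path x y} (h : γ.Homotopic γ') : F γ = F γ' := by
  obtain ⟨K⟩ := h
  have h_square := hF.map_square K.toContinuousMap (bottom := .const I x) (top := .const I y)
    (left := γ) (right := γ') K.source K.target K.apply_zero K.apply_one
  rw [hF.map_const, hF.map_const, mul_one, one_mul] at h_square
  exact h_square.symm

/-- The homomorphism from the fundamental group induced by a flat transport function. Transport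
multiplies from right to left, as do the loops in Mathlib's `FundamentalGroup`. -/
def fundamentalGroupHom (x : X) : FundamentalGroup X x →* H where
  toFun := Quotient.lift (fun γ : Path x x => F γ) fun _ _ h => hF.map_eq_of_homotopic h
  map_one' := hF.map_const x
  map_mul' p q := by
    induction p, q using Path.Homotopic.Quotient.ind₂ with | mk γ γ' =>
    exact hF.map_trans γ' γ

end IsFlatTransport

open Path.Homotopic in
theorem exists_isFlatTransport_fundamentalGroup [PathConnectedSpace X] (x : X) :
    ∃ F : C(I, X) → FundamentalGroup X x, IsFlatTransport F ∧
      ∀ γ : Path x x, F γ = FundamentalGroup.fromPath (.mk γ) := by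
  obtain ⟨c, hc⟩ : ∃ c : ∀ y, Path.Homotopic.Quotient x y, c x = .refl x := by
    let d (y : X) : Path.Homotopic.Quotient x y := .mk (PathConnectedSpace.somePath x y)
    exact ⟨fun y => (d x).symm.trans (d y), Quotient.symm_trans _⟩
  let conj {y z : X} (p : Path.Homotopic.Quotient y z) : FundamentalGroup X x :=
    (c y).trans (p.trans (c z).symm)
  let F (γ : C(I, X)) : FundamentalGroup X x := conj (.mk (⟨γ, rfl, rfl⟩ : Path (γ 0) (γ 1)))
  have hF {y z : X} (γ : Path y z) : F γ = conj (.mk γ) := by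
    obtain ⟨γ, rfl, rfl⟩ := γ
    rfl
  refine ⟨F, isFlatTransport_of_map_trans (fun γ γ' => ?_) (fun h => ?_), fun γ => ?_⟩
  · simp only [hF, conj, FundamentalGroup.mul_def, Quotient.mk_trans, Quotient.trans_assoc]
    rw [← Quotient.trans_assoc (Quotient.symm _) (c _), Quotient.symm_trans, Quotient.refl_trans]
  · rw [hF, hF, Path.Homotopic.Quotient.eq.mpr h]
  · have symm_refl : (Quotient.refl x).symm = .refl x := by
      rw [← Quotient.mk_refl, ← Quotient.mk_symm, Path.refl_symm]
    simp only [hF, conj, hc, symm_refl, Quotient.trans_refl, Quotient.refl_trans]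

end FlatTransport

/-! ### Locally flat transport and gluing -/

section LocalToGlobal

variable {X Y T H Q : Type*} [TopologicalSpace X] [TopologicalSpace Y] [TopologicalSpace T]
  [Group H] [MulAction H Q]

theorem eq_of_locally_path_constant {β : Type*} {f : I → β}
    (hf : ∀ s, ∃ N ∈ 𝓝 s, ∀ p : C(I, I), (∀ t, p t ∈ N) → f (p 0) = f (p 1)) :
    f 0 = f 1 := by
  refine (IsLocallyConstant.iff_eventually_eq f).2 (fun s => ?_) |>.apply_eq_of_isPreconnected
    isPreconnected_univ trivial trivial
  obtain ⟨N, hN, h⟩ := hf s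
  have := (convex_Icc (0 : ℝ) 1).locallyPathConnectedSpace
  obtain ⟨V, hV, hVN⟩ := (LocallyPathConnectedSpace.path_connected_basis s).mem_iff.mp hN
  filter_upwards [hV.1] with t ht
  obtain ⟨p, hp⟩ := hV.2.joinedIn t ht s (mem_of_mem_nhds hV.1)
  simpa using h p.toContinuousMap fun r => hVN (hp r)

/-- The local version of `IsParallelAlong`: each point of `T` has a neighbourhood on whose paths
`U` follows the transport. -/
def IsLocallyParallelAlong (F : C(I, X) → H) (g : C(T, X)) (U : T → Q) : Prop :=
  ∀ z, ∃ N ∈ 𝓝 z, ∀ p : C(I, T), (∀ t, p t ∈ N) → F (g.comp p) • U (p 0) = U (p 1)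

theorem IsParallelAlong.isLocallyParallelAlong {F : C(I, X) → H} {g : C(T, X)} {U : T → Q}
    (hU : IsParallelAlong F g U) : IsLocallyParallelAlong F g U :=
  fun _ => ⟨Set.univ, Filter.univ_mem, fun p _ => hU p⟩

theorem IsLocallyParallelAlong.comp {F : C(I, X) → H} {g : C(T, X)} {U : T → Q}
    (hU : IsLocallyParallelAlong F g U) (k : C(Y, T)) :
    IsLocallyParallelAlong F (g.comp k) (U ∘ k) := by
  intro y
  obtain ⟨N, hN, h⟩ := hU (k y)
  exact ⟨k ⁻¹' N, k.continuous.continuousAt hN, fun p hp => h (k.comp p) hp⟩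

theorem IsLocallyParallelAlong.inv_smul_eq {F : C(I, X) → H} {γ : C(I, X)} {f : I → H} {U : I → Q}
    (hf : IsLocallyParallelAlong F γ f) (hU : IsLocallyParallelAlong F γ U) :
    (f 0)⁻¹ • U 0 = (f 1)⁻¹ • U 1 := by
  refine eq_of_locally_path_constant (f := fun s => (f s)⁻¹ • U s) fun s => ?_
  obtain ⟨N, hN, h⟩ := hf s
  obtain ⟨N', hN', h'⟩ := hU s
  refine ⟨N ∩ N', Filter.inter_mem hN hN', fun p hp => ?_⟩
  rw [← h p fun t => (hp t).1, ← h' p fun t => (hp t).2]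
  simp [smul_smul]

theorem IsFlatTransport.isParallelAlong_of_locally {F : C(I, X) → H} (hF : IsFlatTransport F)
    {g : C(T, X)} {U : T → Q} (hU : IsLocallyParallelAlong F g U) : IsParallelAlong F g U := by
  intro p
  obtain ⟨f, hf₀, hf⟩ := hF.exists_isParallelAlong (g.comp p) 0 (1 : H)
  have h_transport : F (g.comp p) = f 1 := by simpa [hf₀] using hf (.id I)
  have h := hf.isLocallyParallelAlong.inv_smul_eq (hU.comp p)
  rwa [hf₀, inv_one, one_smul, eq_inv_smul_iff, ← h_transport] at h

/-- A transport function is locally flat if each point has a neighbourhood on which it is flat. -/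
def IsLocallyFlatTransport (G : C(I, X) → H) : Prop :=
  ∀ x, ∃ V ∈ 𝓝 x, IsFlatTransport fun γ : C(I, V) => G (.comp ⟨_, continuous_subtype_val⟩ γ)

theorem IsLocallyFlatTransport.map_const {G : C(I, X) → H} (hG : IsLocallyFlatTransport G) (x : X) :
    G (.const I x) = 1 := by
  obtain ⟨V, hV, h⟩ := hG x
  exact h.map_const ⟨x, mem_of_mem_nhds hV⟩

end LocalToGlobal

section ConvexExistence

variable {E X Y H : Type*} [NormedAddCommGroup E] [NormedSpace ℝ E] [TopologicalSpace X]
  [TopologicalSpace Y] [Group H] {s : Set E}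

/-- The segment from `x` to `y` in a convex set. -/
def segmentPath (hs : Convex ℝ s) (x y : s) : C(I, s) where
  toFun t := ⟨AffineMap.lineMap (x : E) (y : E) (t : ℝ), hs.lineMap_mem x.2 y.2 t.2⟩
  continuous_toFun := by fun_prop

variable {G : C(I, X) → H} {g : C(s, X)} {δ : ℝ}

theorem IsLocallyFlatTransport.exists_parallel_on_balls (hG : IsLocallyFlatTransport G)
    (hs : Convex ℝ s) (hc : IsCompact s) (g : C(s, X)) :
    ∃ δ > 0, ∀ x : s, ∃ h : s → H, ∀ p : C(I, s), (∀ t, dist (p t) x < δ) →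
      G (g.comp p) * h (p 0) = h (p 1) := by
  classical
  choose V hV hGV using fun z : s => hG (g z)
  have := isCompact_iff_compactSpace.mp hc
  obtain ⟨δ, hδ, hball⟩ := lebesgue_number_lemma_of_metric (isCompact_univ (X := s))
    (fun z => (isOpen_interior (s := g ⁻¹' V z)))
    (fun z _ => Set.mem_iUnion.mpr
      ⟨z, mem_interior_iff_mem_nhds.mpr (g.continuous.continuousAt (hV z))⟩)
  refine ⟨δ, hδ, fun x => ?_⟩
  obtain ⟨z, hz⟩ := hball x trivial
  let B : Set E := s ∩ Metric.ball x δ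
  have := (hs.inter (convex_ball (x : E) δ)).contractibleSpace ⟨x, x.2, Metric.mem_ball_self hδ⟩
  have hgB (y : B) : (⟨y, y.2.1⟩ : s) ∈ g ⁻¹' V z := interior_subset (hz y.2.2)
  let gB : C(B, V z) := ⟨fun y => ⟨g ⟨y, y.2.1⟩, hgB y⟩, by fun_prop⟩
  obtain ⟨U, -, hU⟩ :=
    (hGV z).exists_isParallelAlong gB ⟨x, x.2, Metric.mem_ball_self hδ⟩ (1 : H)
  refine ⟨fun y => if hy : dist y x < δ then U ⟨y, y.2, hy⟩ else 1, fun p hp => ?_⟩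
  simp only [hp, dif_pos]
  exact hU ⟨fun t => ⟨p t, (p t).2, hp t⟩, by fun_prop⟩

theorem IsLocallyParallelAlong.of_dist_lt (hs : Convex ℝ s)
    (hδ : ∀ x : s, ∃ h : s → H, ∀ p : C(I, s), (∀ t, dist (p t) x < δ) →
      G (g.comp p) * h (p 0) = h (p 1))
    {k k' : C(Y, s)} (hk : ∀ y, dist (k' y) (k y) < δ) {f : Y → H}
    (hf : IsLocallyParallelAlong G (g.comp k) f) :
    IsLocallyParallelAlong G (g.comp k')
      fun y => G (g.comp (segmentPath hs (k y) (k' y))) * f y := by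
  intro y
  obtain ⟨N, hN, hfN⟩ := hf y
  obtain ⟨h, hh⟩ := hδ (k y)
  have hδ₀ : 0 < δ := dist_nonneg.trans_lt (hk y)
  have near : ∀ᶠ z in 𝓝 y, z ∈ N ∧ dist (k z) (k y) < δ ∧ dist (k' z) (k y) < δ :=
    (Filter.eventually_mem_set.mpr hN).and <|
      ((by fun_prop : Continuous fun z => dist (k z) (k y)).continuousAt.eventually_lt
        continuousAt_const (by simpa)).and <|
      (by fun_prop : Continuous fun z => dist (k' z) (k y)).continuousAt.eventually_lt
        continuousAt_const (hk y)
  have h_segment (z : Y) (hz : dist (k z) (k y) < δ) (hz' : dist (k' z) (k y) < δ) :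
      G (g.comp (segmentPath hs (k z) (k' z))) * h (k z) = h (k' z) := by
    simpa [segmentPath] using hh (segmentPath hs (k z) (k' z)) fun t =>
      (convex_ball (k y : E) δ).lineMap_mem hz hz' t.2
  refine ⟨_, near, fun p hp => ?_⟩
  have h_along := hh (k.comp p) fun t => (hp t).2.1
  have h_along' := hh (k'.comp p) fun t => (hp t).2.2
  have h_start := h_segment (p 0) (hp 0).2.1 (hp 0).2.2
  have h_end := h_segment (p 1) (hp 1).2.1 (hp 1).2.2
  have h_square : G (g.comp (k'.comp p)) * G (g.comp (segmentPath hs (k (p 0)) (k' (p 0)))) =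
      G (g.comp (segmentPath hs (k (p 1)) (k' (p 1)))) * G (g.comp (k.comp p)) := by
    apply mul_right_cancel (b := h (k (p 0)))
    rw [mul_assoc, h_start, mul_assoc]
    exact h_along'.trans (h_end.symm.trans (congrArg _ h_along.symm))
  simp only [← hfN p fun t => (hp t).1, smul_eq_mul, ← mul_assoc]
  exact congrArg (· * f (p 0)) h_square

theorem IsLocallyFlatTransport.exists_isLocallyParallelAlong (hG : IsLocallyFlatTransport G)
    (hs : Convex ℝ s) (hc : IsCompact s) (hne : s.Nonempty) (g : C(s, X)) :
    ∃ f : s → H, IsLocallyParallelAlong G g f := by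
  obtain ⟨δ, hδ₀, hδ⟩ := hG.exists_parallel_on_balls hs hc g
  obtain ⟨z₀, hz₀⟩ := hne
  have := isCompact_iff_compactSpace.mp hc
  let shrink : C(I × s, s) :=
    ⟨fun q => segmentPath hs ⟨z₀, hz₀⟩ q.2 q.1, by
      simp only [segmentPath, ContinuousMap.coe_mk, AffineMap.lineMap_apply_module]
      fun_prop⟩
  let HasParallel (r : I) : Prop :=
    ∃ f : s → H, IsLocallyParallelAlong G (g.comp (shrink.curry r)) f
  have h_const : IsLocallyConstant HasParallel := by
    refine (IsLocallyConstant.iff_eventually_eq _).2 fun r => ?_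
    filter_upwards [shrink.curry.continuous.continuousAt.eventually
      (Metric.ball_mem_nhds (shrink.curry r) hδ₀)] with r' h_dist
    have close (y : s) : dist (shrink.curry r' y) (shrink.curry r y) < δ :=
      (ContinuousMap.dist_apply_le_dist y).trans_lt h_dist
    exact propext
      ⟨fun ⟨_, hf⟩ => ⟨_, hf.of_dist_lt hs hδ fun y => (dist_comm _ _).trans_lt (close y)⟩,
      fun ⟨_, hf⟩ => ⟨_, hf.of_dist_lt hs hδ close⟩⟩
  have h_zero : HasParallel 0 := by
    have shrink_zero : shrink.curry 0 = .const s ⟨z₀, hz₀⟩ := by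
      ext; simp [shrink, segmentPath]
    refine ⟨1, fun z => ⟨Set.univ, Filter.univ_mem, fun p _ => ?_⟩⟩
    rw [shrink_zero, Pi.one_apply, Pi.one_apply, smul_eq_mul, mul_one]
    exact hG.map_const (g ⟨z₀, hz₀⟩)
  have h_one : HasParallel 1 :=
    h_const.apply_eq_of_isPreconnected isPreconnected_univ trivial trivial ▸ h_zero
  have shrink_one : shrink.curry 1 = .id s := by ext; simp [shrink, segmentPath]
  simpa [HasParallel, shrink_one] using h_one

theorem IsLocallyFlatTransport.exists_isFlatTransport {G : C(I, X) → H}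
    (hG : IsLocallyFlatTransport G) :
    ∃ F : C(I, X) → H, IsFlatTransport F ∧
      ∀ γ : C(I, X), IsFlatTransport (fun p : C(I, I) => G (γ.comp p)) → F γ = G γ := by
  have h_path (γ : C(I, X)) : ∃ f : I → H, IsLocallyParallelAlong G γ f :=
    hG.exists_isLocallyParallelAlong (convex_Icc 0 1) isCompact_Icc ⟨0, unitInterval.zero_mem⟩ γ
  have h_square (K : C(I × I, X)) : ∃ f : I × I → H, IsLocallyParallelAlong G K f := by
    let e : I ×ˢ I ≃ₜ I × I := Homeomorph.Set.prod I I
    obtain ⟨f, hf⟩ := hG.exists_isLocallyParallelAlong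
      ((convex_Icc (0 : ℝ) 1).prod (convex_Icc (0 : ℝ) 1)) (isCompact_Icc.prod isCompact_Icc)
      ⟨0, unitInterval.zero_mem, unitInterval.zero_mem⟩ (K.comp ⟨e, e.continuous⟩)
    simpa [ContinuousMap.comp_assoc] using ⟨_, hf.comp ⟨e.symm, e.symm.continuous⟩⟩
  choose f hf using h_path
  have f_unique (γ : C(I, X)) (f' : I → H) (hf' : IsLocallyParallelAlong G γ f') :
      f γ 1 * (f γ 0)⁻¹ = f' 1 * (f' 0)⁻¹ := by
    rw [mul_inv_eq_iff_eq_mul, mul_assoc, ← inv_mul_eq_iff_eq_mul]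
    simpa using (hf'.inv_smul_eq (hf γ)).symm
  refine ⟨fun γ => f γ 1 * (f γ 0)⁻¹, fun K => ?_, fun γ hγ => ?_⟩
  · obtain ⟨k, hk⟩ := h_square K
    exact ⟨k, fun p => by simp [f_unique _ _ (hk.comp p)]⟩
  · obtain ⟨f', -, hf'⟩ := hγ.exists_isParallelAlong (.id I) 0 (1 : H)
    have hf'' : G γ • f' 0 = f' 1 := hf' (.id I)
    simp [f_unique γ f' hf'.isLocallyParallelAlong, ← hf'']

end ConvexExistence

section VanKampen

variable {X Y Y₁ Y₂ T H Q : Type*} [TopologicalSpace X] [TopologicalSpace Y] [TopologicalSpace Y₁]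
  [TopologicalSpace Y₂] [TopologicalSpace T] [Group H] [MulAction H Q]

theorem exists_comp_eq_of_isEmbedding {e : C(Y, X)} (he : IsEmbedding e) {g : C(T, X)}
    (hg : ∀ t, g t ∈ Set.range e) : ∃ g' : C(T, Y), e.comp g' = g := by
  choose g' hg' using hg
  have h_comp : e ∘ g' = g := funext hg'
  exact ⟨⟨g', he.continuous_iff.mpr (h_comp ▸ g.continuous)⟩, ContinuousMap.ext hg'⟩

theorem IsFlatTransport.restrict_range {e : C(Y, X)} (he : IsEmbedding e) {G : C(I, X) → H}
    (hG : IsFlatTransport fun γ => G (e.comp γ)) :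
    IsFlatTransport fun γ : C(I, Set.range e) => G (.comp ⟨_, continuous_subtype_val⟩ γ) := by
  intro K
  obtain ⟨K', hK'⟩ := exists_comp_eq_of_isEmbedding he
    (g := .comp ⟨Subtype.val, continuous_subtype_val⟩ K) fun z => (K z).2
  obtain ⟨f, hf⟩ := hG K'
  exact ⟨f, fun p => (congrArg (fun g => G (g.comp p) • f (p 0)) hK').symm.trans (hf p)⟩

theorem exists_isFlatTransport_of_isOpenEmbedding {e₁ : C(Y₁, X)} {e₂ : C(Y₂, X)}
    (he₁ : IsOpenEmbedding e₁) (he₂ : IsOpenEmbedding e₂)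
    (h_cover : ∀ x, x ∈ Set.range e₁ ∨ x ∈ Set.range e₂)
    {G₁ : C(I, Y₁) → H} {G₂ : C(I, Y₂) → H} (hG₁ : IsFlatTransport G₁) (hG₂ : IsFlatTransport G₂)
    (h_compat : ∀ γ₁ γ₂, e₁.comp γ₁ = e₂.comp γ₂ → G₁ γ₁ = G₂ γ₂) :
    ∃ F : C(I, X) → H, IsFlatTransport F ∧
      (∀ γ, F (e₁.comp γ) = G₁ γ) ∧ ∀ γ, F (e₂.comp γ) = G₂ γ := by
  obtain ⟨G, h₁, h₂⟩ : ∃ G : C(I, X) → H,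
      (∀ γ, G (e₁.comp γ) = G₁ γ) ∧ ∀ γ, G (e₂.comp γ) = G₂ γ := by
    have inj₁ : Function.Injective (e₁.comp : C(I, Y₁) → C(I, X)) :=
      fun _ _ => (ContinuousMap.cancel_left he₁.injective).mp
    have inj₂ : Function.Injective (e₂.comp : C(I, Y₂) → C(I, X)) :=
      fun _ _ => (ContinuousMap.cancel_left he₂.injective).mp
    refine ⟨Function.extend e₁.comp G₁ (Function.extend e₂.comp G₂ 1), fun γ => ?_, fun γ => ?_⟩
    · exact inj₁.extend_apply _ _ _
    · by_cases h : ∃ γ₁, e₁.comp γ₁ = e₂.comp γ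
      · obtain ⟨γ₁, h⟩ := h
        rw [← h, inj₁.extend_apply, h_compat γ₁ γ h]
      · rw [Function.extend_apply' _ _ _ h, inj₂.extend_apply]
  have flat₁ : IsFlatTransport fun γ => G (e₁.comp γ) := by simpa only [h₁] using hG₁
  have flat₂ : IsFlatTransport fun γ => G (e₂.comp γ) := by simpa only [h₂] using hG₂
  have hG : IsLocallyFlatTransport G := fun x => (h_cover x).elim
    (fun hx => ⟨_, he₁.isOpen_range.mem_nhds hx, flat₁.restrict_range he₁.isEmbedding⟩)
    (fun hx => ⟨_, he₂.isOpen_range.mem_nhds hx, flat₂.restrict_range he₂.isEmbedding⟩)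
  obtain ⟨F, hF, hFG⟩ := hG.exists_isFlatTransport
  exact ⟨F, hF, fun γ => (hFG _ (flat₁.comp γ)).trans (h₁ γ),
    fun γ => (hFG _ (flat₂.comp γ)).trans (h₂ γ)⟩

theorem IsParallelAlong.smul_eq_of_mem_range {F : C(I, X) → H} {e : C(Y, X)} (he : IsEmbedding e)
    {U : X → Q} (hU : IsParallelAlong F e (U ∘ e)) {γ : C(I, X)} (hγ : ∀ t, γ t ∈ Set.range e) :
    F γ • U (γ 0) = U (γ 1) := by
  obtain ⟨p, rfl⟩ := exists_comp_eq_of_isEmbedding he hγ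
  exact hU p

theorem IsFlatTransport.isParallelAlong_of_isOpenEmbedding {F : C(I, X) → H}
    (hF : IsFlatTransport F) {e₁ : C(Y₁, X)} {e₂ : C(Y₂, X)}
    (he₁ : IsOpenEmbedding e₁) (he₂ : IsOpenEmbedding e₂)
    (h_cover : ∀ x, x ∈ Set.range e₁ ∨ x ∈ Set.range e₂) {U : X → Q}
    (hU₁ : IsParallelAlong F e₁ (U ∘ e₁)) (hU₂ : IsParallelAlong F e₂ (U ∘ e₂)) :
    IsParallelAlong F (.id X) U :=
  hF.isParallelAlong_of_locally fun x => (h_cover x).elim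
    (fun hx => ⟨_, he₁.isOpen_range.mem_nhds hx, fun _ => hU₁.smul_eq_of_mem_range he₁.isEmbedding⟩)
    (fun hx => ⟨_, he₂.isOpen_range.mem_nhds hx, fun _ => hU₂.smul_eq_of_mem_range he₂.isEmbedding⟩)

end VanKampen

/-! ### Attaching cells -/

section CellAttachment

open Metric

section UnitDisc

variable (E : Type*) [NormedAddCommGroup E]

/-- The closed unit disc of a normed space. -/
abbrev UnitDisc : Type _ := closedBall (0 : E) 1

/-- The boundary of the closed unit disc. -/
abbrev UnitSphere : Type _ := sphere (0 : E) 1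

/-- The interior of the closed unit disc. -/
abbrev OpenDisc : Type _ := ball (0 : E) 1

variable {E}

/-- The inclusion of the boundary into the closed disc. -/
def boundaryIncl : C(UnitSphere E, UnitDisc E) := .inclusion sphere_subset_closedBall

/-- The inclusion of the interior into the closed disc. -/
def interiorIncl : C(OpenDisc E, UnitDisc E) := .inclusion ball_subset_closedBall

@[simp]
theorem coe_boundaryIncl (y : UnitSphere E) : (boundaryIncl y : E) = y := rfl

theorem isClosedEmbedding_boundaryIncl :
    IsClosedEmbedding (boundaryIncl : UnitSphere E → UnitDisc E) :=
  .inclusion sphere_subset_closedBall (isClosed_sphere.preimage continuous_subtype_val)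

theorem isOpenEmbedding_interiorIncl : IsOpenEmbedding (interiorIncl : OpenDisc E → UnitDisc E) :=
  .inclusion ball_subset_closedBall (isOpen_ball.preimage continuous_subtype_val)

theorem exists_boundaryIncl_eq {y : UnitDisc E} (hy : ‖(y : E)‖ = 1) :
    ∃ z : UnitSphere E, boundaryIncl z = y :=
  ⟨⟨y, mem_sphere_zero_iff_norm.mpr hy⟩, rfl⟩

theorem exists_interiorIncl_eq {y : UnitDisc E} (hy : ‖(y : E)‖ < 1) :
    ∃ z : OpenDisc E, interiorIncl z = y :=
  ⟨⟨y, mem_ball_zero_iff.mpr hy⟩, rfl⟩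

theorem norm_eq_one_or_lt_one (y : UnitDisc E) : ‖(y : E)‖ = 1 ∨ ‖(y : E)‖ < 1 :=
  eq_or_lt_of_le (mem_closedBall_zero_iff.mp y.2)

variable [NormedSpace ℝ E]

instance contractibleSpace_unitDisc : ContractibleSpace (UnitDisc E) :=
  (convex_closedBall (0 : E) 1).contractibleSpace ⟨0, mem_closedBall_self zero_le_one⟩

/-- The radial deformation of the disc that pushes the points of norm at least `1 / 2` to the
boundary and fixes the boundary. -/
def stretch : C(UnitDisc E × I, UnitDisc E) where
  toFun p := ⟨((1 + p.2 : ℝ) / max 1 ((1 + p.2) * ‖(p.1 : E)‖)) • (p.1 : E), by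
    have h_pos : (0 : ℝ) < 1 + p.2 := by linarith [p.2.2.1]
    rw [mem_closedBall_zero_iff, norm_smul, Real.norm_of_nonneg (by positivity),
      div_mul_eq_mul_div, div_le_one (lt_max_of_lt_left one_pos)]
    exact le_max_right _ _⟩
  continuous_toFun := by
    have h_ne (p : UnitDisc E × I) : max 1 ((1 + p.2 : ℝ) * ‖(p.1 : E)‖) ≠ 0 :=
      (lt_max_of_lt_left one_pos).ne'
    fun_prop (disch := exact h_ne)

theorem stretch_zero (y : UnitDisc E) : stretch (y, 0) = y := by
  ext1
  simp [stretch, mem_closedBall_zero_iff.mp y.2]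

theorem stretch_boundaryIncl (y : UnitSphere E) (s : I) :
    stretch (boundaryIncl y, s) = boundaryIncl y := by
  have h_le : (1 : ℝ) ≤ 1 + s := by linarith [s.2.1]
  ext1
  simp [stretch, norm_eq_of_mem_sphere y, max_eq_right h_le,
    div_self (zero_lt_one.trans_le h_le).ne']

theorem norm_stretch_one {y : UnitDisc E} (hy : 1 / 2 < ‖(y : E)‖) :
    ‖(stretch (y, 1) : E)‖ = 1 := by
  have h_le : (1 : ℝ) ≤ (1 + 1) * ‖(y : E)‖ := by linarith
  have h_pos : (0 : ℝ) < (1 + 1) * ‖(y : E)‖ := zero_lt_one.trans_le h_le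
  simp only [stretch, ContinuousMap.coe_mk, Set.Icc.coe_one, max_eq_right h_le]
  rw [norm_smul, Real.norm_of_nonneg (by positivity), div_mul_eq_mul_div, div_self h_pos.ne']

end UnitDisc

/-- The open cells with characteristic maps `χ i`, as a map from their disjoint union. -/
def openCells {E ι X : Type*} [NormedAddCommGroup E] [TopologicalSpace X]
    (χ : ι → C(UnitDisc E, X)) : C(Σ _ : ι, OpenDisc E, X) :=
  .sigma fun i => (χ i).comp interiorIncl

/-- The space `X` is obtained from `A` by attaching discs along the maps `φ i`: it has the quotient
topology of `A ⊔ ∐ i, UnitDisc E`, in which each boundary point of a disc is identified with its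
image in `A` and there are no further identifications. -/
structure IsCellAttachment {E ι A X : Type*} [NormedAddCommGroup E] [TopologicalSpace A]
    [TopologicalSpace X] (φ : ι → C(UnitSphere E, A)) (j : C(A, X))
    (χ : ι → C(UnitDisc E, X)) : Prop where
  isQuotientMap : IsQuotientMap (Sum.elim j fun p : Σ _ : ι, UnitDisc E => χ p.1 p.2)
  map_boundary (i : ι) (y : UnitSphere E) : χ i (boundaryIncl y) = j (φ i y)
  injective : Function.Injective (Sum.elim j (openCells χ))

namespace IsCellAttachment

variable {E ι A X Z : Type*} [NormedAddCommGroup E] [TopologicalSpace A] [TopologicalSpace X]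
  {φ : ι → C(UnitSphere E, A)} {j : C(A, X)} {χ : ι → C(UnitDisc E, X)}
  (hX : IsCellAttachment φ j χ)
include hX

theorem injective_incl : Function.Injective j :=
  hX.injective.comp Sum.inl_injective

theorem openCells_ne (p : Σ _ : ι, OpenDisc E) (a : A) : openCells χ p ≠ j a :=
  fun h => Sum.inr_ne_inl (hX.injective h)

theorem surjective : Function.Surjective (Sum.elim j (openCells χ)) := by
  intro x
  obtain ⟨a | ⟨i, y⟩, rfl⟩ := hX.isQuotientMap.surjective x
  · exact ⟨.inl a, rfl⟩
  · rcases norm_eq_one_or_lt_one y with hy | hy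
    · obtain ⟨z, rfl⟩ := exists_boundaryIncl_eq hy
      exact ⟨.inl (φ i z), (hX.map_boundary i z).symm⟩
    · obtain ⟨z, rfl⟩ := exists_interiorIncl_eq hy
      exact ⟨.inr ⟨i, z⟩, rfl⟩

theorem exists_lift (u : A → Z) (v : ι → UnitDisc E → Z)
    (h_boundary : ∀ i y, v i (boundaryIncl y) = u (φ i y)) :
    ∃ f : X → Z, (∀ a, f (j a) = u a) ∧ ∀ i y, f (χ i y) = v i y := by
  let e := Equiv.ofBijective _ ⟨hX.injective, hX.surjective⟩
  let f : X → Z := Sum.elim u (fun p => v p.1 (interiorIncl p.2)) ∘ e.symm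
  have hf (z : A ⊕ Σ _ : ι, OpenDisc E) :
      f (e z) = Sum.elim u (fun p => v p.1 (interiorIncl p.2)) z := by simp [f]
  have hf_incl (a : A) : f (j a) = u a := hf (.inl a)
  refine ⟨f, hf_incl, fun i y => ?_⟩
  rcases norm_eq_one_or_lt_one y with hy | hy
  · obtain ⟨z, rfl⟩ := exists_boundaryIncl_eq hy
    rw [hX.map_boundary, hf_incl, h_boundary]
  · obtain ⟨z, rfl⟩ := exists_interiorIncl_eq hy
    exact hf (.inr ⟨i, z⟩)

theorem continuous_iff [TopologicalSpace Z] {f : X → Z} :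
    Continuous f ↔ Continuous (f ∘ j) ∧ ∀ i, Continuous (f ∘ χ i) := by
  rw [hX.isQuotientMap.continuous_iff, continuous_sum_dom, continuous_sigma_iff]
  rfl

theorem exists_continuous_lift [TopologicalSpace Z] (u : C(A, Z)) (v : ι → C(UnitDisc E, Z))
    (h_boundary : ∀ i y, v i (boundaryIncl y) = u (φ i y)) :
    ∃ f : C(X, Z), (∀ a, f (j a) = u a) ∧ ∀ i y, f (χ i y) = v i y := by
  obtain ⟨f, hu, hv⟩ := hX.exists_lift u (fun i => v i) h_boundary
  refine ⟨⟨f, hX.continuous_iff.mpr ⟨?_, fun i => ?_⟩⟩, hu, hv⟩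
  · simpa only [show f ∘ j = u from funext hu] using u.continuous
  · simpa only [show f ∘ χ i = v i from funext (hv i)] using (v i).continuous

theorem isClosedEmbedding_incl : IsClosedEmbedding j := by
  refine .of_continuous_injective_isClosedMap j.continuous hX.injective_incl fun C hC => ?_
  refine hX.isQuotientMap.isClosed_preimage.mp <|
    isClosed_sum_iff.mpr ⟨?_, isClosed_sigma_iff.mpr fun i => ?_⟩
  · exact (Set.preimage_image_eq C hX.injective_incl).symm ▸ hC
  · convert isClosedEmbedding_boundaryIncl.isClosedMap _ (hC.preimage (φ i).continuous) using 1
    ext y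
    constructor
    · rintro ⟨a, ha, h_eq⟩
      rcases norm_eq_one_or_lt_one y with hy | hy
      · obtain ⟨z, rfl⟩ := exists_boundaryIncl_eq hy
        obtain rfl := hX.injective_incl (h_eq.trans (hX.map_boundary i z))
        exact ⟨z, ha, rfl⟩
      · obtain ⟨z, rfl⟩ := exists_interiorIncl_eq hy
        exact absurd h_eq.symm (hX.openCells_ne ⟨i, z⟩ a)
    · rintro ⟨z, hz, rfl⟩
      exact ⟨φ i z, hz, (hX.map_boundary i z).symm⟩

theorem isOpenEmbedding_openCells : IsOpenEmbedding (openCells χ) := by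
  have h_inj : Function.Injective (openCells χ) := hX.injective.comp Sum.inr_injective
  refine .of_continuous_injective_isOpenMap (map_continuous _) h_inj fun V hV => ?_
  refine hX.isQuotientMap.isOpen_preimage.mp <|
    isOpen_sum_iff.mpr ⟨?_, isOpen_sigma_iff.mpr fun i => ?_⟩
  · convert isOpen_empty using 1
    exact Set.eq_empty_of_forall_notMem fun a ⟨p, _, h_eq⟩ => hX.openCells_ne p a h_eq
  · convert isOpenEmbedding_interiorIncl.isOpenMap _ (isOpen_sigma_iff.mp hV i) using 1
    ext y
    constructor
    · rintro ⟨p, hp, h_eq⟩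
      rcases norm_eq_one_or_lt_one y with hy | hy
      · obtain ⟨z, rfl⟩ := exists_boundaryIncl_eq hy
        exact absurd (h_eq.trans (hX.map_boundary i z)) (hX.openCells_ne p _)
      · obtain ⟨z, rfl⟩ := exists_interiorIncl_eq hy
        obtain rfl : p = ⟨i, z⟩ := h_inj h_eq
        exact ⟨z, hp, rfl⟩
    · rintro ⟨z, hz, rfl⟩
      exact ⟨⟨i, z⟩, hz, rfl⟩

theorem pathConnectedSpace [NormedSpace ℝ E] [Nontrivial E] [PathConnectedSpace A] :
    PathConnectedSpace X := by
  obtain ⟨y₀⟩ := NormedSpace.sphere_nonempty_rclike (E := E) ℝ zero_le_one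
  obtain ⟨a₀⟩ : Nonempty A := inferInstance
  refine pathConnectedSpace_iff_eq.mpr ⟨j a₀, Set.eq_univ_of_forall fun x => ?_⟩
  have joined_incl (a : A) : Joined (j a₀) (j a) :=
    (PathConnectedSpace.joined a₀ a).map j.continuous
  obtain ⟨a | ⟨i, y⟩, rfl⟩ := hX.surjective x
  · exact joined_incl a
  · have joined_disc : Joined (χ i (boundaryIncl y₀)) (χ i (interiorIncl y)) :=
      (PathConnectedSpace.joined _ _).map (χ i).continuous
    exact (joined_incl (φ i y₀)).trans (hX.map_boundary i y₀ ▸ joined_disc)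

end IsCellAttachment

namespace IsCellAttachment

variable {E ι A X H Q : Type*} [NormedAddCommGroup E] [NormedSpace ℝ E] [TopologicalSpace A]
  [TopologicalSpace X] [Group H] [MulAction H Q]
  {φ : ι → C(UnitSphere E, A)} {j : C(A, X)} {χ : ι → C(UnitDisc E, X)}

variable (j χ) in
/-- An open neighbourhood of `A` in `X` that meets each disc in the points of norm greater than
`1 / 2`, together with the radial deformation of `X` that retracts it to `A`. -/
structure Collar where
  nhd : Set X
  isOpen : IsOpen nhd
  incl_mem (a : A) : j a ∈ nhd
  disc_mem_iff (i : ι) (y : UnitDisc E) : χ i y ∈ nhd ↔ 1 / 2 < ‖(y : E)‖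
  deform : C(X, C(I, X))
  deform_incl (a : A) : deform (j a) = .const I (j a)
  deform_disc (i : ι) (y : UnitDisc E) (t : I) : deform (χ i y) t = χ i (stretch (y, t))
  retract : C(nhd, A)
  incl_retract (x : nhd) : j (retract x) = deform x 1

section

variable (hX : IsCellAttachment φ j χ)
include hX

theorem nonempty_collar : Nonempty (Collar j χ) := by
  obtain ⟨radius, radius_incl, radius_disc⟩ := hX.exists_continuous_lift (.const A (1 : ℝ))
    (fun _ => ⟨fun y : UnitDisc E => ‖(y : E)‖, by fun_prop⟩)
    fun _ y => norm_eq_of_mem_sphere y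
  obtain ⟨deform, deform_incl, deform_disc⟩ := hX.exists_continuous_lift
    (ContinuousMap.const'.comp j) (fun i => ((χ i).comp stretch).curry) fun i y => by
      ext t
      simp [stretch_boundaryIncl, hX.map_boundary]
  obtain ⟨retract, h_retract⟩ := exists_comp_eq_of_isEmbedding
    hX.isClosedEmbedding_incl.isEmbedding
    (g := (⟨fun x => deform x.1 1, by fun_prop⟩ : C(radius ⁻¹' Set.Ioi (1 / 2), X))) <| by
      rintro ⟨x, hx⟩
      obtain ⟨a | ⟨i, y⟩, rfl⟩ := hX.isQuotientMap.surjective x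
      · exact ⟨a, by simp [deform_incl]⟩
      · obtain ⟨z, hz⟩ := exists_boundaryIncl_eq (norm_stretch_one (y := y) <| by
          simpa [radius_disc] using hx)
        exact ⟨φ i z, by simp [← hX.map_boundary, hz, deform_disc]⟩
  exact ⟨{
    nhd := radius ⁻¹' Set.Ioi (1 / 2)
    isOpen := isOpen_Ioi.preimage radius.continuous
    incl_mem := fun a => by norm_num [radius_incl]
    disc_mem_iff := fun i y => by simp [radius_disc]
    deform
    deform_incl := deform_incl
    deform_disc := fun i y t => by simp [deform_disc]
    retract
    incl_retract := fun x => congrArg (· x) h_retract }⟩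

theorem Collar.mem_nhd_or_mem_range (c : Collar j χ) (x : X) :
    x ∈ c.nhd ∨ x ∈ Set.range (openCells χ) := by
  obtain ⟨a | p, rfl⟩ := hX.surjective x
  exacts [.inl (c.incl_mem a), .inr ⟨p, rfl⟩]

/-- The inclusion of a collar. -/
def Collar.subtypeVal (c : Collar j χ) : C(c.nhd, X) := ⟨Subtype.val, continuous_subtype_val⟩

theorem Collar.deform_zero (c : Collar j χ) (x : X) : c.deform x 0 = x := by
  obtain ⟨a | ⟨i, y⟩, rfl⟩ := hX.isQuotientMap.surjective x
  · simp [c.deform_incl]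
  · simp [c.deform_disc, stretch_zero]

theorem Collar.isParallelAlong_subtypeVal (c : Collar j χ) {F : C(I, X) → H}
    (hF : IsFlatTransport F) {U : X → Q} (hU_incl : IsParallelAlong F j (U ∘ j))
    (hU_disc : ∀ i, IsParallelAlong F (χ i) (U ∘ χ i)) :
    IsParallelAlong F c.subtypeVal (U ∘ c.subtypeVal) := by
  intro p
  have along_track (x : X) : F (c.deform x) • U x = U (c.deform x 1) := by
    obtain ⟨a | ⟨i, y⟩, rfl⟩ := hX.isQuotientMap.surjective x
    · simp [c.deform_incl, hF.map_const]
    · have h := (hU_disc i).smul_eq ⟨fun t => stretch (y, t), by fun_prop⟩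
        fun t => (c.deform_disc i y t).symm
      simpa [stretch_zero, c.deform_disc] using h
  have along_retract :
      F (j.comp (c.retract.comp p)) • U (c.deform (p 0) 1) = U (c.deform (p 1) 1) := by
    simpa [c.incl_retract] using hU_incl (c.retract.comp p)
  have h_square := hF.map_square ⟨fun z : I × I => c.deform (p z.1) z.2, by fun_prop⟩
    (bottom := c.subtypeVal.comp p) (top := j.comp (c.retract.comp p))
    (left := c.deform (p 0)) (right := c.deform (p 1))
    (fun _ => c.deform_zero hX _) (fun _ => (c.incl_retract _).symm) (fun _ => rfl) (fun _ => rfl)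
  apply smul_left_cancel (F (c.deform (p 1)))
  rw [smul_smul, h_square, mul_smul, Function.comp_apply, Function.comp_apply]
  exact (congrArg _ (along_track _)).trans (along_retract.trans (along_track _).symm)

theorem isParallelAlong_id {F : C(I, X) → H} (hF : IsFlatTransport F) {U : X → Q}
    (hU_incl : IsParallelAlong F j (U ∘ j)) (hU_disc : ∀ i, IsParallelAlong F (χ i) (U ∘ χ i)) :
    IsParallelAlong F (.id X) U := by
  obtain ⟨c⟩ := hX.nonempty_collar
  refine hF.isParallelAlong_of_isOpenEmbedding (e₁ := c.subtypeVal)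
    c.isOpen.isOpenEmbedding_subtypeVal hX.isOpenEmbedding_openCells
    (fun x => ?_) (c.isParallelAlong_subtypeVal hX hF hU_incl hU_disc) fun p => ?_
  · simpa [Collar.subtypeVal] using c.mem_nhd_or_mem_range hX x
  · obtain ⟨i, p, rfl⟩ := p.exists_lift_sigma
    exact hU_disc i (interiorIncl.comp p)

theorem exists_parallel_extension {F : C(I, X) → H} (hF : IsFlatTransport F)
    {U : A → Q} (hU : IsParallelAlong F j U) (y₀ : UnitSphere E)
    (hU_boundary : ∀ i y, ∃ p : C(I, UnitDisc E), p 0 = boundaryIncl y₀ ∧ p 1 = boundaryIncl y ∧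
      F ((χ i).comp p) • U (φ i y₀) = U (φ i y)) :
    ∃ V : X → Q, (∀ a, V (j a) = U a) ∧ IsParallelAlong F (.id X) V := by
  choose W hW₀ hW using fun i => hF.exists_isParallelAlong (χ i) (boundaryIncl y₀) (U (φ i y₀))
  obtain ⟨V, hV_incl, hV_disc⟩ := hX.exists_lift U W fun i y => by
    obtain ⟨p, hp₀, hp₁, hp⟩ := hU_boundary i y
    rw [← hp₁, ← hW i p, hp₀, hW₀, hp]
  refine ⟨V, hV_incl, hX.isParallelAlong_id hF ?_ fun i => ?_⟩
  · rwa [show V ∘ j = U from funext hV_incl]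
  · rw [show V ∘ χ i = W i from funext (hV_disc i)]
    exact hW i

theorem Collar.exists_retract_eq (c : Collar j χ) {i : ι} {γ : C(I, c.nhd)} {p : C(I, UnitDisc E)}
    (hp : ∀ t, γ t = χ i (p t)) : ∃ q : C(I, UnitSphere E),
      (∀ t, boundaryIncl (q t) = stretch (p t, 1)) ∧ c.retract.comp γ = (φ i).comp q := by
  have hp_norm (t : I) : 1 / 2 < ‖(p t : E)‖ := (c.disc_mem_iff i _).mp (hp t ▸ (γ t).2)
  obtain ⟨q, hq⟩ := exists_comp_eq_of_isEmbedding isClosedEmbedding_boundaryIncl.isEmbedding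
    (g := (⟨fun t => stretch (p t, 1), by fun_prop⟩ : C(I, UnitDisc E)))
    fun t => exists_boundaryIncl_eq (norm_stretch_one (hp_norm t))
  have hq (t : I) : boundaryIncl (q t) = stretch (p t, 1) := congrArg (· t) hq
  refine ⟨q, hq, ContinuousMap.ext fun t => hX.injective_incl ?_⟩
  calc j (c.retract (γ t)) = χ i (stretch (p t, 1)) := by rw [c.incl_retract, hp, c.deform_disc]
    _ = j (φ i (q t)) := by rw [← hq, hX.map_boundary]

omit hX in
theorem Collar.isParallelAlong_disc (c : Collar j χ) {F : C(I, X) → H} (hF : IsFlatTransport F)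
    {i : ι} {f : UnitDisc E → Q}
    (h_nhd : ∀ p : C(I, UnitDisc E), (∀ t, χ i (p t) ∈ c.nhd) →
      F ((χ i).comp p) • f (p 0) = f (p 1))
    (h_interior : IsParallelAlong F ((χ i).comp interiorIncl) (f ∘ interiorIncl)) :
    IsParallelAlong F (χ i) f := by
  refine hF.isParallelAlong_of_locally fun y => ?_
  rcases norm_eq_one_or_lt_one y with hy | hy
  · exact ⟨_, (c.isOpen.preimage (χ i).continuous).mem_nhds
      ((c.disc_mem_iff i y).mpr (by norm_num [hy])), h_nhd⟩
  · refine ⟨_, isOpenEmbedding_interiorIncl.isOpen_range.mem_nhds (exists_interiorIncl_eq hy),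
      fun p hp => ?_⟩
    obtain ⟨p, rfl⟩ := exists_comp_eq_of_isEmbedding isOpenEmbedding_interiorIncl.isEmbedding hp
    exact h_interior p

theorem exists_flat_extension {F : C(I, A) → H} (hF : IsFlatTransport F)
    {v : ι → UnitSphere E → H} (hv : ∀ i, IsParallelAlong F (φ i) (v i)) :
    ∃ F' : C(I, X) → H, IsFlatTransport F' ∧ (∀ γ, F' (j.comp γ) = F γ) ∧
      ∀ i, ∃ f : UnitDisc E → H, (∀ y, f (boundaryIncl y) = v i y) ∧
        IsParallelAlong F' (χ i) f := by
  obtain ⟨c⟩ := hX.nonempty_collar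
  choose f hf using fun i : ι => (⟨Function.extend boundaryIncl (v i) 1,
    isClosedEmbedding_boundaryIncl.injective.extend_apply _ _⟩ :
      ∃ f : UnitDisc E → H, ∀ y, f (boundaryIncl y) = v i y)
  have f_along {i : ι} {γ : C(I, c.nhd)} {p : C(I, UnitDisc E)} (hp : ∀ t, γ t = χ i (p t)) :
      F (c.retract.comp γ) * f i (stretch (p 0, 1)) = f i (stretch (p 1, 1)) := by
    obtain ⟨q, hq, h_retract⟩ := c.exists_retract_eq hX hp
    rw [h_retract, ← hq, ← hq, hf, hf]
    exact hv i q
  obtain ⟨F', hF', h_collar, h_cells⟩ := exists_isFlatTransport_of_isOpenEmbedding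
    (e₁ := c.subtypeVal) c.isOpen.isOpenEmbedding_subtypeVal hX.isOpenEmbedding_openCells
    (fun x => by simpa [Collar.subtypeVal] using c.mem_nhd_or_mem_range hX x)
    (hF.comp c.retract)
    (isFlatTransport_coboundary fun p => f p.1 (stretch (interiorIncl p.2, 1)))
    fun γ p h => by
      obtain ⟨i, p, rfl⟩ := p.exists_lift_sigma
      exact eq_mul_inv_of_mul_eq <| f_along (p := interiorIncl.comp p) fun t => congrArg (· t) h
  refine ⟨F', hF', fun γ => ?_, fun i => ⟨fun y => f i (stretch (y, 1)), fun y => ?_, ?_⟩⟩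
  · let γ' : C(I, c.nhd) := ⟨fun t => ⟨j (γ t), c.incl_mem _⟩, by fun_prop⟩
    rw [show F' (j.comp γ) = F (c.retract.comp γ') from h_collar γ']
    congr 1
    ext t
    exact hX.injective_incl (by simp [c.incl_retract, γ', c.deform_incl])
  · simp only [stretch_boundaryIncl, hf]
  · refine c.isParallelAlong_disc hF' (fun p hp => ?_) fun p => ?_
    · have h_along := f_along (γ := ⟨fun t => ⟨χ i (p t), hp t⟩, by fun_prop⟩) fun _ => rfl
      rwa [← h_collar] at h_along
    · exact eq_mul_inv_iff_mul_eq.mp (h_cells (.comp (.sigmaMk i) p))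

end

end IsCellAttachment

end CellAttachment

namespace IsCellAttachment

section AttachCells

open Limits HomotopicalAlgebra TopCat

variable {n : ℕ} {ι A X : Type u} [TopologicalSpace A] [TopologicalSpace X]

/-- A map on the unit sphere, as a morphism of `TopCat` on the lifted sphere `∂𝔻 n`. -/
def sphereHom (φ : C(UnitSphere (EuclideanSpace ℝ (Fin n)), A)) : ∂𝔻 n ⟶ TopCat.of A :=
  ofHom ⟨fun y => φ y.down, φ.continuous.comp continuous_uliftDown⟩

/-- A map on the closed disc, as a morphism of `TopCat` on the lifted disc `𝔻 n`. -/
def discHom (χ : C(UnitDisc (EuclideanSpace ℝ (Fin n)), X)) : 𝔻 n ⟶ TopCat.of X :=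
  ofHom ⟨fun y => χ y.down, χ.continuous.comp continuous_uliftDown⟩

variable {φ : ι → C(UnitSphere (EuclideanSpace ℝ (Fin n)), A)} {j : C(A, X)}
  {χ : ι → C(UnitDisc (EuclideanSpace ℝ (Fin n)), X)} (hX : IsCellAttachment φ j χ)
include hX

theorem existsUnique_hom {Z : TopCat.{u}} (u : TopCat.of A ⟶ Z) (v : ι → (𝔻 n ⟶ Z))
    (h_boundary : ∀ i, sphereHom (φ i) ≫ u = diskBoundaryInclusion n ≫ v i) :
    ∃! f : TopCat.of X ⟶ Z, ofHom j ≫ f = u ∧ ∀ i, discHom (χ i) ≫ f = v i := by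
  obtain ⟨f, hu, hv⟩ := hX.exists_continuous_lift u.hom
    (fun i => (v i).hom.comp ⟨ULift.up, continuous_uliftUp⟩)
    fun i y => (ConcreteCategory.congr_hom (h_boundary i) ⟨y⟩).symm
  refine ⟨ofHom f, ⟨?_, fun i => ?_⟩, fun g ⟨hu', hv'⟩ => ?_⟩
  · ext a
    exact hu a
  · ext y
    exact hv i y.down
  · ext x
    obtain ⟨a | ⟨i, y⟩, rfl⟩ := hX.isQuotientMap.surjective x
    · exact (ConcreteCategory.congr_hom hu' a).trans (hu a).symm
    · exact (ConcreteCategory.congr_hom (hv' i) ⟨y⟩).trans (hv i y).symm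

theorem isPushout :
    IsPushout (Limits.Sigma.desc fun i => sphereHom (φ i))
      (Limits.Sigma.map fun _ : ι => diskBoundaryInclusion.{u} n) (ofHom j)
      (Limits.Sigma.desc fun i => discHom (χ i)) := by
  have h_comm (i : ι) : sphereHom (φ i) ≫ ofHom j = diskBoundaryInclusion n ≫ discHom (χ i) := by
    ext y
    exact (hX.map_boundary i y.down).symm
  refine ⟨⟨Limits.Sigma.hom_ext _ _ fun i => by simp [h_comm]⟩, ⟨?_⟩⟩
  have h_boundary (s : PushoutCocone (Limits.Sigma.desc fun i => sphereHom (φ i))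
      (Limits.Sigma.map fun _ : ι => diskBoundaryInclusion.{u} n)) (i : ι) :
      sphereHom (φ i) ≫ s.inl =
        diskBoundaryInclusion n ≫ Limits.Sigma.ι (fun _ : ι => 𝔻 n) i ≫ s.inr := by
    rw [← Limits.Sigma.ι_desc (fun i => sphereHom (φ i)) i, Category.assoc, s.condition,
      Limits.Sigma.ι_map_assoc]
  choose desc h_desc h_unique using fun s => hX.existsUnique_hom s.inl _ (h_boundary s)
  refine PushoutCocone.IsColimit.mk _ desc (fun s => (h_desc s).1)
    (fun s => Limits.Sigma.hom_ext _ _ fun i => ?_)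
    fun s f hf_inl hf_inr => h_unique s f ⟨hf_inl, fun i => ?_⟩
  · simpa using (h_desc s).2 i
  · simp [← hf_inr]

/-- A space obtained by attaching discs of dimension `n`, as an attachment of basic cells in the
sense of relative CW-complexes. -/
def attachCells : AttachCells.{u} (RelativeCWComplex.basicCell n) (ofHom j) where
  ι := ι
  π _ := ()
  cofan₁ := Cofan.mk (∐ fun _ : ι => ∂𝔻 n) (Limits.Sigma.ι _)
  cofan₂ := Cofan.mk (∐ fun _ : ι => 𝔻 n) (Limits.Sigma.ι _)
  isColimit₁ := coproductIsCoproduct _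
  isColimit₂ := coproductIsCoproduct _
  m := Limits.Sigma.map fun _ => diskBoundaryInclusion n
  hm i := Limits.Sigma.ι_map _ i
  g₁ := Limits.Sigma.desc fun i => sphereHom (φ i)
  g₂ := Limits.Sigma.desc fun i => discHom (χ i)
  isPushout := hX.isPushout

theorem cell_attachCells (i : ι) : hX.attachCells.cell i = discHom (χ i) :=
  Limits.Sigma.ι_desc _ _

end AttachCells

section Degenerate

open Metric

variable {E ι A X : Type*} [NormedAddCommGroup E] [TopologicalSpace A] [TopologicalSpace X]

theorem of_isEmpty [IsEmpty ι] (φ : ι → C(UnitSphere E, X)) (χ : ι → C(UnitDisc E, X)) :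
    IsCellAttachment φ (.id X) χ where
  isQuotientMap := .of_comp continuous_inl
    (continuous_sum_dom.mpr ⟨continuous_id, continuous_of_const fun p => isEmptyElim p.1⟩) .id
  map_boundary i := isEmptyElim i
  injective := Function.injective_id.sumElim (fun p => isEmptyElim p.1) fun _ p => isEmptyElim p.1

theorem of_subsingleton [Subsingleton E] [IsEmpty A] [DiscreteTopology X]
    (φ : ι → C(UnitSphere E, A)) (j : C(A, X)) (e : ι ≃ X) :
    IsCellAttachment φ j fun i => .const _ (e i) where
  isQuotientMap := by
    let center (x : X) : A ⊕ Σ _ : ι, UnitDisc E :=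
      .inr ⟨e.symm x, 0, mem_closedBall_self zero_le_one⟩
    exact .of_inverse (f := center) continuous_of_discreteTopology (by fun_prop) e.apply_symm_apply
  map_boundary _ y := isEmptyElim (φ _ y)
  injective := by
    refine (Function.injective_of_subsingleton _).sumElim ?_ fun a => isEmptyElim a
    rintro ⟨i, y⟩ ⟨i', y'⟩ h
    obtain rfl : i = i' := e.injective h
    rw [Subsingleton.elim y y']

end Degenerate

end IsCellAttachment

/-! ### The wedge of circles -/

section Circle

/-- The path that runs once, counterclockwise, around the circle, starting at `1`. -/
def windingPath : C(I, Circle) := ⟨fun t => Circle.exp (2 * Real.pi * t), by fun_prop⟩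

theorem isQuotientMap_windingPath : IsQuotientMap windingPath := by
  refine .of_surjective_continuous (fun z => ?_) windingPath.continuous
  obtain ⟨x, ⟨hx₀, hx₁⟩, hx⟩ :=
    Circle.periodic_exp.exists_mem_Ico₀ Real.two_pi_pos (Complex.arg z)
  refine ⟨⟨x / (2 * Real.pi), by positivity, (div_le_one Real.two_pi_pos).mpr hx₁.le⟩, ?_⟩
  rw [← Circle.exp_arg z, hx]
  exact congrArg Circle.exp (mul_div_cancel₀ x Real.two_pi_pos.ne')

variable {X H : Type*} [TopologicalSpace X] [Group H] {x : X}

theorem apply_eq_of_windingPath_eq (γ : Path x x) {s t : I} (h : windingPath s = windingPath t) :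
    γ s = γ t := by
  wlog h_le : t ≤ s generalizing s t
  · exact (this h.symm (le_of_not_ge h_le)).symm
  replace h_le : (t : ℝ) ≤ s := h_le
  obtain ⟨m, hm⟩ := Circle.exp_eq_exp.mp h
  have h_eq : (s : ℝ) = t + m := by
    refine mul_left_cancel₀ Real.two_pi_pos.ne' (hm.trans ?_)
    ring
  have h_lower : 0 ≤ m := by exact_mod_cast (by linarith : (0 : ℝ) ≤ m)
  have h_upper : m ≤ 1 := by exact_mod_cast (by linarith [s.2.2, t.2.1] : (m : ℝ) ≤ 1)
  obtain rfl | rfl : m = 0 ∨ m = 1 := by omega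
  · rw [show s = t from Subtype.ext (by simpa using h_eq)]
  · rw [Int.cast_one] at h_eq
    obtain rfl : s = 1 := Subtype.ext (le_antisymm s.2.2 (by linarith [t.2.1] : (1 : ℝ) ≤ s))
    obtain rfl : t = 0 := Subtype.ext (by simpa using h_eq)
    rw [γ.source, γ.target]

/-- The map on the circle defined by a loop. -/
def loopOnCircle (γ : Path x x) : C(Circle, X) :=
  isQuotientMap_windingPath.lift γ.toContinuousMap fun _ _ => apply_eq_of_windingPath_eq γ

theorem loopOnCircle_windingPath (γ : Path x x) (t : I) :
    loopOnCircle γ (windingPath t) = γ t :=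
  DFunLike.congr_fun (isQuotientMap_windingPath.lift_comp γ.toContinuousMap
    fun _ _ => apply_eq_of_windingPath_eq γ) t

theorem exists_isParallelAlong_loopOnCircle {F : C(I, X) → H} (hF : IsFlatTransport F)
    {γ : Path x x} (hγ : F γ = 1) : ∃ f : Circle → H, IsParallelAlong F (loopOnCircle γ) f := by
  let unroll : C(ℝ, X) := (loopOnCircle γ).comp Circle.exp
  obtain ⟨U, -, hU⟩ := hF.exists_isParallelAlong unroll 0 (1 : H)
  let segment (a b : ℝ) : C(I, ℝ) := ⟨fun t => a + t * (b - a), by fun_prop⟩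
  have h_zero : U (2 * Real.pi) = U 0 := by
    have h := hU.smul_eq (γ := γ) (segment 0 (2 * Real.pi)) fun t => by
      refine Eq.trans ?_ (loopOnCircle_windingPath γ t)
      simp [unroll, segment, windingPath, mul_comm]
    simpa [hγ, segment] using h.symm
  have h_periodic : U.Periodic (2 * Real.pi) := fun a => by
    have from_zero : F (unroll.comp (segment 0 a)) • U 0 = U a := by
      simpa [segment] using hU (segment 0 a)
    have from_two_pi : F (unroll.comp (segment 0 a)) • U (2 * Real.pi) = U (a + 2 * Real.pi) := by
      have h := hU.smul_eq (γ := unroll.comp (segment 0 a))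
        (segment (2 * Real.pi) (a + 2 * Real.pi)) fun t => by
          simp [unroll, segment, add_comm, Circle.periodic_exp _]
      simpa [segment, add_comm] using h
    rw [← from_two_pi, h_zero, from_zero]
  refine ⟨fun z => U (Complex.arg z), fun p => ?_⟩
  obtain ⟨q, hq, -⟩ := Circle.isCoveringMap_exp.exists_path_lifts p (Complex.arg (p 0))
    (Circle.exp_arg _).symm
  have h_arg (t : I) : U (Complex.arg (p t)) = U (q t) := by
    obtain ⟨m, hm⟩ := Circle.exp_eq_exp.mp ((Circle.exp_arg (p t)).trans (congrFun hq t).symm)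
    rw [hm]
    exact h_periodic.int_mul m (q t)
  simp only [h_arg]
  exact hU.smul_eq q fun t => congrArg (loopOnCircle γ) (congrFun hq t)

end Circle

section Diameter

theorem norm_eq_abs_apply_zero (y : EuclideanSpace ℝ (Fin 1)) : ‖y‖ = |y 0| := by
  simp [EuclideanSpace.norm_eq, Real.sqrt_sq_eq_abs]

/-- The parametrization of the closed `1`-dimensional disc by the unit interval. -/
def diameter : C(I, UnitDisc (EuclideanSpace ℝ (Fin 1))) where
  toFun t := ⟨!₂[2 * (t : ℝ) - 1], by
    rw [mem_closedBall_zero_iff, norm_eq_abs_apply_zero]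
    exact abs_le.mpr ⟨by simp [t.2.1], show 2 * (t : ℝ) - 1 ≤ 1 by linarith [t.2.2]⟩⟩
  continuous_toFun := by fun_prop

theorem diameter_apply_zero (t : I) : (diameter t : EuclideanSpace ℝ (Fin 1)) 0 = 2 * t - 1 := rfl

theorem apply_zero_eq_one_or_neg_one (y : UnitSphere (EuclideanSpace ℝ (Fin 1))) :
    y.1 0 = 1 ∨ y.1 0 = -1 := by
  rw [← abs_eq zero_le_one, ← norm_eq_abs_apply_zero, norm_eq_of_mem_sphere y]

theorem boundaryIncl_eq_diameter (y : UnitSphere (EuclideanSpace ℝ (Fin 1))) :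
    boundaryIncl y = diameter 0 ∨ boundaryIncl y = diameter 1 := by
  have ext_zero {z : UnitDisc (EuclideanSpace ℝ (Fin 1))} (h : y.1 0 = z.1 0) :
      boundaryIncl y = z := by
    ext k
    rwa [Subsingleton.elim k 0]
  rcases apply_zero_eq_one_or_neg_one y with hy | hy
  · exact .inr (ext_zero (hy.trans (by norm_num [diameter_apply_zero])))
  · exact .inl (ext_zero (hy.trans (by norm_num [diameter_apply_zero])))

theorem exists_boundaryIncl_eq_diameter_zero :
    ∃ y : UnitSphere (EuclideanSpace ℝ (Fin 1)), boundaryIncl y = diameter 0 :=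
  exists_boundaryIncl_eq (by simp [norm_eq_abs_apply_zero, diameter_apply_zero])

theorem exists_boundaryIncl_eq_diameter_one :
    ∃ y : UnitSphere (EuclideanSpace ℝ (Fin 1)), boundaryIncl y = diameter 1 :=
  exists_boundaryIncl_eq (by norm_num [norm_eq_abs_apply_zero, diameter_apply_zero])

instance finite_unitSphere : Finite (UnitSphere (EuclideanSpace ℝ (Fin 1))) :=
  .of_injective
    (fun y => (⟨boundaryIncl y, boundaryIncl_eq_diameter y⟩ : ({diameter 0, diameter 1} : Set _)))
    fun _ _ h => isClosedEmbedding_boundaryIncl.injective (congrArg Subtype.val h)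

end Diameter

namespace CircleWedge

variable {α : Type u}

/-- The characteristic map of the `1`-cell with index `a`. -/
def cellMap (a : α) : C(UnitDisc (EuclideanSpace ℝ (Fin 1)), CircleWedge α) where
  toFun y := circle a (Circle.exp (Real.pi * (y.1 0 + 1)))
  continuous_toFun := (continuous_circle a).comp (by fun_prop)

theorem cellMap_diameter (a : α) (t : I) : cellMap a (diameter t) = loop a t :=
  congrArg (fun x => circle a (Circle.exp x)) (by rw [diameter_apply_zero]; ring)

theorem cellMap_boundaryIncl (a : α) (y : UnitSphere (EuclideanSpace ℝ (Fin 1))) :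
    cellMap a (boundaryIncl y) = base := by
  rcases boundaryIncl_eq_diameter y with hy | hy
  · rw [hy, cellMap_diameter, Path.source]
  · rw [hy, cellMap_diameter, Path.target]

open Classical in
/-- Recovers the points of the wedge other than the wedge point, which is sent to `none`. -/
def puncture : CircleWedge α → Option (Σ _ : α, Circle) :=
  Quot.lift (Sum.elim (fun _ => none) fun p => if p.2 = 1 then none else some p) <| by
    rintro _ _ ⟨a⟩
    exact if_pos rfl

theorem puncture_circle (a : α) {z : Circle} (hz : z ≠ 1) : puncture (circle a z) = some ⟨a, z⟩ :=
  if_neg hz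

theorem injective_base_openCells : Function.Injective
    (Sum.elim (.const PUnit.{u + 1} base : C(PUnit, CircleWedge α)) (openCells cellMap)) := by
  let angle (y : OpenDisc (EuclideanSpace ℝ (Fin 1))) : ℝ := Real.pi * (y.1 0 + 1)
  have angle_mem (y) : 0 < angle y ∧ angle y < 2 * Real.pi := by
    have hy := abs_lt.mp (norm_eq_abs_apply_zero _ ▸ mem_ball_zero_iff.mp y.2)
    exact ⟨mul_pos Real.pi_pos (by linarith), by nlinarith [Real.pi_pos]⟩
  have exp_injOn : Set.InjOn Circle.exp (Set.Ico 0 (2 * Real.pi)) :=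
    Circle.exp_injOn_Ico (sub_zero _).le
  have exp_ne_one (y) : Circle.exp (angle y) ≠ 1 := fun h =>
    (angle_mem y).1.ne' <| exp_injOn ⟨(angle_mem y).1.le, (angle_mem y).2⟩
      ⟨le_rfl, Real.two_pi_pos⟩ (h.trans Circle.exp_zero.symm)
  have puncture_openCells (p : Σ _ : α, OpenDisc (EuclideanSpace ℝ (Fin 1))) :
      puncture (openCells cellMap p) = some ⟨p.1, Circle.exp (angle p.2)⟩ :=
    puncture_circle p.1 (exp_ne_one p.2)
  refine (Function.injective_of_subsingleton _).sumElim (fun ⟨a, y⟩ ⟨b, z⟩ h => ?_) fun _ p h => ?_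
  · have h_some := congrArg puncture h
    simp only [puncture_openCells, Option.some.injEq, Sigma.mk.injEq, heq_eq_eq] at h_some
    obtain ⟨rfl, h_exp⟩ := h_some
    have h_angle := exp_injOn ⟨(angle_mem y).1.le, (angle_mem y).2⟩
      ⟨(angle_mem z).1.le, (angle_mem z).2⟩ h_exp
    congr 1
    ext k
    rw [Subsingleton.elim k 0]
    simpa [angle, Real.pi_ne_zero] using h_angle
  · cases (congrArg puncture h).trans (puncture_openCells p)

theorem isClosed_iff {s : Set (CircleWedge α)} : IsClosed s ↔ ∀ a, IsClosed (cellMap a ⁻¹' s) := by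
  refine ⟨fun hs a => hs.preimage (cellMap a).continuous, fun hs => ?_⟩
  refine isQuotientMap_quot_mk.isClosed_preimage.mp <| isClosed_sum_iff.mpr
    ⟨isClosed_discrete _, isClosed_sigma_iff.mpr fun a => ?_⟩
  refine isQuotientMap_windingPath.isClosed_preimage.mp ?_
  convert (hs a).preimage diameter.continuous using 1
  ext t
  exact (congrArg (· ∈ s) (cellMap_diameter a t)).to_iff.symm

theorem isCellAttachment :
    IsCellAttachment (fun _ : α => .const _ PUnit.unit) (.const PUnit.{u + 1} base) cellMap where
  isQuotientMap := by
    refine isQuotientMap_iff_isClosed.mpr ⟨fun x => ?_, fun s => ⟨fun hs => ?_, fun hs => ?_⟩⟩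
    · obtain ⟨_ | ⟨a, z⟩, rfl⟩ := Quot.exists_rep x
      · exact ⟨.inl PUnit.unit, rfl⟩
      · obtain ⟨t, rfl⟩ := isQuotientMap_windingPath.surjective z
        exact ⟨.inr ⟨a, diameter t⟩, cellMap_diameter a t⟩
    · exact isClosed_sum_iff.mpr
        ⟨hs.preimage (ContinuousMap.continuous _), isClosed_sigma_iff.mpr (isClosed_iff.mp hs)⟩
    · exact isClosed_iff.mpr (isClosed_sigma_iff.mp (isClosed_sum_iff.mp hs).2)
  map_boundary := cellMap_boundaryIncl
  injective := injective_base_openCells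

instance : PathConnectedSpace (CircleWedge α) := (isCellAttachment (α := α)).pathConnectedSpace

theorem exists_isFlatTransport {H : Type*} [Group H] (h : α → H) :
    ∃ F : C(I, CircleWedge α) → H, IsFlatTransport F ∧ ∀ a, F (loop a) = h a := by
  let v (a : α) (y : UnitSphere (EuclideanSpace ℝ (Fin 1))) : H :=
    if (boundaryIncl y : EuclideanSpace ℝ (Fin 1)) 0 = 1 then h a else 1
  obtain ⟨F, hF, -, hF_cell⟩ := isCellAttachment.exists_flat_extension
    (isFlatTransport_coboundary fun _ : PUnit => (1 : H)) (v := v) fun a p => by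
      rw [show p 0 = p 1 from PreconnectedSpace.constant inferInstance p.continuous]
      simp
  refine ⟨F, hF, fun a => ?_⟩
  obtain ⟨f, hf_boundary, hf⟩ := hF_cell a
  obtain ⟨y₀, hy₀⟩ := exists_boundaryIncl_eq_diameter_zero
  obtain ⟨y₁, hy₁⟩ := exists_boundaryIncl_eq_diameter_one
  have hf₀ : f (diameter 0) = 1 := by
    rw [← hy₀, hf_boundary]
    norm_num [v, hy₀, diameter_apply_zero, -coe_boundaryIncl]
  have hf₁ : f (diameter 1) = h a := by
    rw [← hy₁, hf_boundary]
    norm_num [v, hy₁, diameter_apply_zero, -coe_boundaryIncl]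
  have h_smul : F (loop a) • f (diameter 0) = f (diameter 1) :=
    hf.smul_eq diameter (cellMap_diameter a)
  rwa [hf₀, hf₁, smul_eq_mul, mul_one] at h_smul

theorem map_wordLoop {H : Type*} [Group H] {F : C(I, CircleWedge α) → H} (hF : IsFlatTransport F)
    (l : List (α × Bool)) :
    F (wordLoop l) = (FreeGroup.lift (fun a => (F (loop a))⁻¹) (FreeGroup.mk l))⁻¹ := by
  induction l with
  | nil => exact (hF.map_const base).trans (inv_eq_one.mpr (map_one _)).symm
  | cons x l ih =>
    have h_letter : F (letterLoop x) =
        (FreeGroup.lift (fun a => (F (loop a))⁻¹) (FreeGroup.mk [x]))⁻¹ := by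
      rcases x with ⟨a, _ | _⟩ <;> simp [letterLoop, hF.map_symm]
    rw [wordLoop, hF.map_trans, ih, h_letter, ← mul_inv_rev, ← map_mul, FreeGroup.mul_mk,
      List.singleton_append]

theorem exists_parallel {Q H : Type*} [Group H] [MulAction H Q] {F : C(I, CircleWedge α) → H}
    (hF : IsFlatTransport F) {q : Q} (hq : ∀ a : α, F (loop a : C(I, CircleWedge α)) • q = q) :
    ∃ U : CircleWedge α → Q, U base = q ∧ IsParallelAlong F (.id _) U := by
  obtain ⟨y₀, hy₀⟩ := exists_boundaryIncl_eq_diameter_zero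
  have parallel_point : IsParallelAlong F (.const PUnit.{u + 1} base) fun _ => q := fun _ =>
    (congrArg (· • q) (hF.map_const base)).trans (one_smul H q)
  obtain ⟨U, hU_base, hU⟩ := isCellAttachment.exists_parallel_extension hF parallel_point y₀
    fun a y => by
      rcases boundaryIncl_eq_diameter y with hy | hy
      · refine ⟨.const I (diameter 0), hy₀.symm, hy.symm, ?_⟩
        exact (congrArg (· • q) (hF.map_const (cellMap a (diameter 0)))).trans (one_smul H q)
      · refine ⟨diameter, hy₀.symm, hy.symm, ?_⟩
        rw [show (cellMap a).comp diameter = loop a from ContinuousMap.ext (cellMap_diameter a), hq]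
  exact ⟨U, hU_base PUnit.unit, hU⟩

end CircleWedge

/-! ### The presentation complex -/

section BoundaryCircle

/-- The boundary of the disc in the Euclidean plane, as the unit circle in the complex plane. -/
def sphereToCircle : C(UnitSphere (EuclideanSpace ℝ (Fin 2)), Circle) where
  toFun y := ⟨Complex.orthonormalBasisOneI.repr.symm y,
    mem_sphere_zero_iff_norm.mpr ((LinearIsometryEquiv.norm_map _ _).trans
      (mem_sphere_zero_iff_norm.mp y.2))⟩
  continuous_toFun := by fun_prop

theorem injective_sphereToCircle : Function.Injective sphereToCircle := fun _ _ h =>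
  Subtype.ext (Complex.orthonormalBasisOneI.repr.symm.injective (congrArg Subtype.val h))

theorem sphereToCircle_eq_windingPath {y : UnitSphere (EuclideanSpace ℝ (Fin 2))} {t : I}
    (hy : boundaryIncl y = boundaryPoint t) : sphereToCircle y = windingPath t := by
  obtain ⟨y, h⟩ := y
  obtain rfl := congrArg Subtype.val hy
  refine Circle.ext ((Complex.orthonormalBasisOneI_repr_symm_apply _).trans ?_)
  simp [windingPath, boundaryPoint, Complex.exp_mul_I]

theorem exists_boundaryIncl_eq_boundaryPoint (t : I) :
    ∃ y : UnitSphere (EuclideanSpace ℝ (Fin 2)), boundaryIncl y = boundaryPoint t :=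
  exists_boundaryIncl_eq (by simp [boundaryPoint, EuclideanSpace.norm_eq])

theorem exists_boundaryPoint_eq_boundaryIncl (y : UnitSphere (EuclideanSpace ℝ (Fin 2))) :
    ∃ t : I, boundaryPoint t = boundaryIncl y := by
  obtain ⟨t, ht⟩ := isQuotientMap_windingPath.surjective (sphereToCircle y)
  obtain ⟨z, hz⟩ := exists_boundaryIncl_eq_boundaryPoint t
  refine ⟨t, hz.symm.trans (congrArg boundaryIncl (injective_sphereToCircle ?_))⟩
  rw [sphereToCircle_eq_windingPath hz, ht]

/-- The loop that runs once around the boundary of the disc. -/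
def boundaryLoop : C(I, ClosedDisc) :=
  ⟨boundaryPoint, Continuous.subtype_mk (by fun_prop) _⟩

theorem boundaryLoop_one : boundaryLoop 1 = boundaryLoop 0 :=
  show boundaryPoint 1 = boundaryPoint 0 from Subtype.ext (by simp [boundaryPoint])

end BoundaryCircle

namespace PresentationComplex

variable {α ι : Type u} (w : ι → List (α × Bool))

/-- The inclusion of the wedge of circles, as a continuous map. -/
def wedgeMap : C(CircleWedge α, PresentationComplex w) :=
  ⟨ofWedge w, continuous_quot_mk.comp continuous_inl⟩

/-- The characteristic map of the disc with index `i`, as a continuous map. -/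
def discMap (i : ι) : C(ClosedDisc, PresentationComplex w) :=
  ⟨ofDisc w i, continuous_quot_mk.comp (continuous_inr.comp continuous_sigmaMk)⟩

/-- The loop of the relator `w i`, as an attaching map. -/
def attachingMap (i : ι) : C(UnitSphere (EuclideanSpace ℝ (Fin 2)), CircleWedge α) :=
  (loopOnCircle (CircleWedge.wordLoop (w i))).comp sphereToCircle

variable {w}

theorem attachingMap_eq {i : ι} {y : UnitSphere (EuclideanSpace ℝ (Fin 2))} {t : I}
    (hy : boundaryIncl y = boundaryPoint t) :
    attachingMap w i y = CircleWedge.wordLoop (w i) t :=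
  (congrArg _ (sphereToCircle_eq_windingPath hy)).trans (loopOnCircle_windingPath _ t)

theorem discMap_comp_boundaryLoop (i : ι) :
    (discMap w i).comp boundaryLoop = (wedgeMap w).comp (CircleWedge.wordLoop (w i)) :=
  ContinuousMap.ext fun t => Quot.sound (Rel.glue i t)

variable (w) in
open Classical in
/-- Writes the complex as the disjoint union of the wedge and the open discs. -/
def decompose :
    PresentationComplex w → CircleWedge α ⊕ Σ _ : ι, OpenDisc (EuclideanSpace ℝ (Fin 2)) :=
  Quot.lift (Sum.elim Sum.inl fun p =>
    if hp : ‖(p.2 : EuclideanSpace ℝ (Fin 2))‖ = 1 then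
      .inl (attachingMap w p.1 ⟨p.2, mem_sphere_zero_iff_norm.mpr hp⟩)
    else .inr ⟨p.1, p.2, mem_ball_zero_iff.mpr <|
      lt_of_le_of_ne (mem_closedBall_zero_iff.mp p.2.2) hp⟩) <| by
    rintro _ _ ⟨i, t⟩
    obtain ⟨y, hy⟩ := exists_boundaryIncl_eq_boundaryPoint t
    have h_norm : ‖(boundaryPoint t : EuclideanSpace ℝ (Fin 2))‖ = 1 :=
      hy ▸ mem_sphere_zero_iff_norm.mp y.2
    exact (dif_pos h_norm).trans (congrArg Sum.inl (attachingMap_eq rfl))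

theorem decompose_sumElim (z : CircleWedge α ⊕ Σ _ : ι, OpenDisc (EuclideanSpace ℝ (Fin 2))) :
    decompose w (Sum.elim (wedgeMap w) (openCells (discMap w)) z) = z := by
  rcases z with x | ⟨i, y⟩
  · rfl
  · exact dif_neg (mem_ball_zero_iff.mp y.2).ne

theorem isCellAttachment : IsCellAttachment (attachingMap w) (wedgeMap w) (discMap w) where
  isQuotientMap := by
    have h_eq : Quot.mk (Rel w) =
        Sum.elim (wedgeMap w) fun p : Σ _ : ι, ClosedDisc => discMap w p.1 p.2 :=
      funext fun z => by cases z <;> rfl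
    exact h_eq ▸ isQuotientMap_quot_mk
  map_boundary i y := by
    obtain ⟨t, ht⟩ := exists_boundaryPoint_eq_boundaryIncl y
    rw [attachingMap_eq ht.symm, ← ht]
    exact DFunLike.congr_fun (discMap_comp_boundaryLoop i) t
  injective := Function.LeftInverse.injective decompose_sumElim

instance pathConnectedSpace : PathConnectedSpace (PresentationComplex w) :=
  isCellAttachment.pathConnectedSpace

open Limits HomotopicalAlgebra TopCat

variable (w)

/-- The terms of the skeletal filtration: the empty space, a point, the wedge of circles, and from
then on the whole complex. -/
def stage : ℕ → TopCat.{u}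
  | 0 => TopCat.of PEmpty
  | 1 => TopCat.of PUnit
  | 2 => TopCat.of (CircleWedge α)
  | _ + 3 => TopCat.of (PresentationComplex w)

/-- The maps of the skeletal filtration. -/
def stageMap : ∀ n, stage w n ⟶ stage w (n + 1)
  | 0 => ofHom (.const PEmpty PUnit.unit)
  | 1 => ofHom (.const PUnit CircleWedge.base)
  | 2 => ofHom (wedgeMap w)
  | _ + 3 => ofHom (.id _)

/-- The maps from the skeletal filtration to the complex. -/
def stageIncl : ∀ n, stage w n ⟶ TopCat.of (PresentationComplex w)
  | 0 => ofHom (.const PEmpty (ofWedge w CircleWedge.base))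
  | 1 => ofHom (.const PUnit (ofWedge w CircleWedge.base))
  | 2 => ofHom (wedgeMap w)
  | _ + 3 => ofHom (.id _)

theorem stageMap_stageIncl : ∀ n, stageMap w n ≫ stageIncl w (n + 1) = stageIncl w n
  | 0 | 1 | 2 | _ + 3 => rfl

/-- The cells attached at the different stages. -/
def attachStage : ∀ n, AttachCells.{u} (RelativeCWComplex.basicCell n) (stageMap w n)
  | 0 => (IsCellAttachment.of_subsingleton (fun _ => ⟨isEmptyElim, continuous_of_const isEmptyElim⟩)
      (.const PEmpty.{u + 1} PUnit.unit) (.refl PUnit.{u + 1})).attachCells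
  | 1 => (CircleWedge.isCellAttachment (α := α)).attachCells
  | 2 => isCellAttachment.attachCells
  | _ + 3 => (IsCellAttachment.of_isEmpty (ι := PEmpty.{u + 1}) isEmptyElim isEmptyElim).attachCells

/-- The inclusion of the skeletal filtration into the complex, as a natural transformation. -/
def stageInclNatTrans : Functor.ofSequence (stageMap w) ⟶
    (Functor.const _).obj (TopCat.of (PresentationComplex w)) :=
  NatTrans.ofSequence (stageIncl w) fun n => by
    rw [Functor.ofSequence_map_homOfLE_succ]
    exact stageMap_stageIncl w n

theorem isIso_stageIncl {n : ℕ} (hn : 3 ≤ n) : IsIso (stageIncl w n) := by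
  obtain ⟨k, rfl⟩ := Nat.exists_eq_add_of_le' hn
  exact inferInstanceAs (IsIso (𝟙 (TopCat.of (PresentationComplex w))))

theorem isEventuallyConstantFrom_stageMap :
    (Functor.ofSequence (stageMap w)).IsEventuallyConstantFrom 3 := fun n f =>
  have : IsIso ((stageInclNatTrans w).app 3) := isIso_stageIncl w le_rfl
  have : IsIso ((stageInclNatTrans w).app n) := isIso_stageIncl w (leOfHom f)
  IsIso.of_isIso_fac_right (((stageInclNatTrans w).naturality f).trans (Category.comp_id _))

/-- The complex is the colimit of its skeletal filtration. -/
def isColimitStageIncl : IsColimit (Cocone.mk _ (stageInclNatTrans w)) :=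
  have : IsIso ((Cocone.mk _ (stageInclNatTrans w)).ι.app 3) := isIso_stageIncl w le_rfl
  (isEventuallyConstantFrom_stageMap w).isColimitOfIsIso _

/-- The CW-structure of a presentation complex whose cells are a point, the circles of the wedge
and the attached discs. -/
def standardCW : TopCat.CWComplex (TopCat.of (PresentationComplex w)) where
  F := Functor.ofSequence (stageMap w)
  isoBot := initialIsoPEmpty.symm
  incl := stageInclNatTrans w
  isColimit := isColimitStageIncl w
  fac := initialIsInitial.hom_ext _ _
  attachCells n _ := { attachStage w n with
    isPushout := (Functor.ofSequence_map_homOfLE_succ (stageMap w) n).symm ▸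
      (attachStage w n).isPushout }

theorem isStandardCW_standardCW : IsStandardCW w (standardCW w) := by
  refine ⟨⟨Equiv.equivPUnit PUnit⟩, fun _ _ => rfl, ⟨Equiv.refl α, fun a x => ?_⟩,
    ⟨Equiv.refl ι, fun i x => ?_⟩, fun n hn => ?_, ⟨Homeomorph.refl (CircleWedge α), fun _ => rfl⟩⟩
  · exact congrArg (ofWedge w)
      (ConcreteCategory.congr_hom (CircleWedge.isCellAttachment.cell_attachCells a) x)
  · exact ConcreteCategory.congr_hom (isCellAttachment.cell_attachCells i) x
  · obtain ⟨n, rfl⟩ := Nat.exists_eq_add_of_lt hn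
    rw [show 2 + n + 1 = n + 3 by omega]
    exact inferInstanceAs (IsEmpty PEmpty)

end PresentationComplex

/-! ### The fundamental group of the presentation complex -/

namespace PresentationComplex

variable {α ι : Type u} {w : ι → List (α × Bool)}

variable (w) in
/-- The loop in the complex around the circle with index `a`. -/
def generatorLoop (a : α) : Path (ofWedge w CircleWedge.base) (ofWedge w CircleWedge.base) :=
  (CircleWedge.loop a).map (wedgeMap w).continuous

section FlatTransport

variable {H : Type*} [Group H]

theorem map_wordLoop_eq_one {F : C(I, PresentationComplex w) → H} (hF : IsFlatTransport F)
    (i : ι) : F ((wedgeMap w).comp (CircleWedge.wordLoop (w i))) = 1 := by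
  obtain ⟨U, -, hU⟩ := hF.exists_isParallelAlong (discMap w i) (boundaryLoop 0) (1 : H)
  have h_boundary := hU boundaryLoop
  rw [discMap_comp_boundaryLoop, boundaryLoop_one] at h_boundary
  exact mul_eq_right.mp h_boundary

theorem lift_map_generatorLoop_eq_one {F : C(I, PresentationComplex w) → H}
    (hF : IsFlatTransport F) {r : FreeGroup α} (hr : r ∈ Set.range fun i => FreeGroup.mk (w i)) :
    FreeGroup.lift (fun a => (F (generatorLoop w a))⁻¹) r = 1 := by
  obtain ⟨i, rfl⟩ := hr
  exact inv_eq_one.mp <|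
    (CircleWedge.map_wordLoop (hF.comp (wedgeMap w)) (w i)).symm.trans (map_wordLoop_eq_one hF i)

theorem exists_isFlatTransport {g : α → H}
    (hg : ∀ i, FreeGroup.lift g (FreeGroup.mk (w i)) = 1) :
    ∃ F : C(I, PresentationComplex w) → H,
      IsFlatTransport F ∧ ∀ a, F (generatorLoop w a) = (g a)⁻¹ := by
  obtain ⟨F₀, hF₀, hF₀_loop⟩ := CircleWedge.exists_isFlatTransport fun a => (g a)⁻¹
  have hF₀_word (i : ι) : F₀ (CircleWedge.wordLoop (w i)) = 1 := by
    simp only [CircleWedge.map_wordLoop hF₀, hF₀_loop, inv_inv, hg, inv_one]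
  choose f hf using fun i => exists_isParallelAlong_loopOnCircle hF₀ (hF₀_word i)
  obtain ⟨F, hF, hF_wedge, -⟩ :=
    isCellAttachment.exists_flat_extension hF₀ fun i => (hf i).comp sphereToCircle
  exact ⟨F, hF, fun a => (hF_wedge (CircleWedge.loop a)).trans (hF₀_loop a)⟩

theorem map_smul_eq_of_generatorLoop {Q : Type*} [MulAction H Q]
    {F : C(I, PresentationComplex w) → H} (hF : IsFlatTransport F) {q : Q}
    (hq : ∀ a, F (generatorLoop w a) • q = q)
    (γ : Path (ofWedge w CircleWedge.base) (ofWedge w CircleWedge.base)) : F γ • q = q := by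
  obtain ⟨U, hU_base, hU⟩ := CircleWedge.exists_parallel (hF.comp (wedgeMap w)) hq
  obtain ⟨y₀, hy₀⟩ := exists_boundaryIncl_eq_boundaryPoint 0
  obtain ⟨V, hV_wedge, hV⟩ := isCellAttachment.exists_parallel_extension hF hU y₀ fun i y => by
    obtain ⟨t, ht⟩ := exists_boundaryPoint_eq_boundaryIncl y
    let arc : C(I, I) := ⟨fun s => s * t, by fun_prop⟩
    have h_zero : arc 0 = 0 := zero_mul t
    have h_one : arc 1 = t := one_mul t
    refine ⟨boundaryLoop.comp arc, ?_, ?_, ?_⟩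
    · exact (congrArg boundaryPoint h_zero).trans hy₀.symm
    · exact (congrArg boundaryPoint h_one).trans ht
    · rw [attachingMap_eq hy₀, attachingMap_eq ht.symm, ← ContinuousMap.comp_assoc,
        discMap_comp_boundaryLoop, ContinuousMap.comp_assoc]
      let relator : C(I, CircleWedge α) := CircleWedge.wordLoop (w i)
      have h_arc : F ((wedgeMap w).comp (relator.comp arc)) • U (relator (arc 0)) =
          U (relator (arc 1)) := hU (relator.comp arc)
      rw [h_zero, h_one] at h_arc
      exact h_arc
  have hV_base : V (ofWedge w CircleWedge.base) = q := (hV_wedge _).trans hU_base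
  have hγ : F γ • V (γ 0) = V (γ 1) := hV γ.toContinuousMap
  rwa [γ.source, γ.target, hV_base] at hγ

theorem map_mem_of_generatorLoop {F : C(I, PresentationComplex w) → H} (hF : IsFlatTransport F)
    {K : Subgroup H} (hK : ∀ a, F (generatorLoop w a) ∈ K)
    (γ : Path (ofWedge w CircleWedge.base) (ofWedge w CircleWedge.base)) : F γ ∈ K := by
  have mem_iff (g : H) : g ∈ K ↔ g • ((1 : H) : H ⧸ K) = (1 : H) := by
    rw [← MulAction.mem_stabilizer_iff, MulAction.stabilizer_quotient]
  exact (mem_iff _).mpr (map_smul_eq_of_generatorLoop hF (fun a => (mem_iff _).mp (hK a)) γ)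

end FlatTransport

theorem nonempty_presentedGroup_mulEquiv_fundamentalGroup :
    Nonempty (PresentedGroup (Set.range fun i => FreeGroup.mk (w i)) ≃*
      FundamentalGroup (PresentationComplex w) (ofWedge w CircleWedge.base)) := by
  obtain ⟨F, hF, hF_loop⟩ := exists_isFlatTransport_fundamentalGroup (ofWedge w CircleWedge.base)
  have of_relator (i : ι) : FreeGroup.lift PresentedGroup.of (FreeGroup.mk (w i)) =
      (1 : PresentedGroup (Set.range fun i => FreeGroup.mk (w i))) :=
    (DFunLike.congr_fun (FreeGroup.ext_hom _ (PresentedGroup.mk _) fun a => FreeGroup.lift_apply_of)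
      _).trans (PresentedGroup.one_of_mem ⟨i, rfl⟩)
  obtain ⟨F', hF', hF'_loop⟩ := exists_isFlatTransport of_relator
  let toLoops := PresentedGroup.toGroup fun _ => lift_map_generatorLoop_eq_one hF
  let ofLoops := hF'.fundamentalGroupHom (ofWedge w CircleWedge.base)
  have toLoops_of (a : α) : toLoops (.of a) = (F (generatorLoop w a))⁻¹ :=
    PresentedGroup.toGroup.of _
  have ofLoops_map (γ : Path (ofWedge w CircleWedge.base) (ofWedge w CircleWedge.base)) :
      ofLoops (F γ) = F' γ := congrArg ofLoops (hF_loop γ)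
  have h_left : ofLoops.comp toLoops = .id _ := PresentedGroup.ext fun a => by
    rw [MonoidHom.comp_apply, toLoops_of, map_inv, ofLoops_map, hF'_loop, inv_inv,
      MonoidHom.id_apply]
  refine ⟨.ofBijective toLoops
    ⟨Function.LeftInverse.injective (DFunLike.congr_fun h_left), fun p => ?_⟩⟩
  induction p using Path.Homotopic.Quotient.ind with | mk γ =>
  have generator_mem (a : α) : F (generatorLoop w a) ∈ toLoops.range :=
    ⟨(.of a)⁻¹, by rw [map_inv, toLoops_of, inv_inv]⟩
  obtain ⟨g, hg⟩ := map_mem_of_generatorLoop hF generator_mem γ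
  exact ⟨g, hg.trans (hF_loop γ)⟩

theorem nonempty_fundamentalGroup_mulEquiv {G : Type u} [Group G] (hw : Presents w G)
    (x : PresentationComplex w) : Nonempty (FundamentalGroup (PresentationComplex w) x ≃* G) := by
  obtain ⟨e⟩ := hw
  obtain ⟨e'⟩ := nonempty_presentedGroup_mulEquiv_fundamentalGroup (w := w)
  exact ⟨(FundamentalGroup.fundamentalGroupMulEquivOfPathConnected _ _).trans (e'.symm.trans e)⟩

end PresentationComplex

theorem exists_presents (G : Type u) [Group G] :
    ∃ (α ι : Type u) (w : ι → List (α × Bool)), Nonempty ι ∧ Presents w G := by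
  classical
  let π : FreeGroup G →* G := FreeGroup.lift id
  refine ⟨G, π.ker, fun r => r.1.toWord, ⟨1⟩, ?_⟩
  have range_eq_ker : (Set.range fun r : π.ker => FreeGroup.mk r.1.toWord) = π.ker := by
    ext r
    simp [FreeGroup.mk_toWord]
  rw [Presents, range_eq_ker]
  exact ⟨(QuotientGroup.quotientMulEquivOfEq (Subgroup.normalClosure_eq_self _)).trans
    (QuotientGroup.quotientKerEquivOfSurjective π fun g => ⟨FreeGroup.of g, by simp [π]⟩)⟩

end

theorem mainTheorem10 (G : Type u) [Group G] :
    (∃ (X : TopCat.{u}) (c : TopCat.CWComplex X), c.HasDimension 2 ∧ PathConnectedSpace X ∧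
      ∀ x : X, Nonempty (FundamentalGroup X x ≃* G)) ∧
    (∃ (α ι : Type u) (w : ι → List (α × Bool)), Nonempty ι ∧ Presents w G) ∧
    (∀ (α ι : Type u) (w : ι → List (α × Bool)), Presents w G →
      (∃ c : TopCat.CWComplex (TopCat.of (PresentationComplex w)),
        PresentationComplex.IsStandardCW w c) ∧
      PathConnectedSpace (PresentationComplex w) ∧
      ∀ x : PresentationComplex w, Nonempty (FundamentalGroup (PresentationComplex w) x ≃* G)) := by
  refine ⟨?_, exists_presents G, fun α ι w hw =>
    ⟨⟨_, PresentationComplex.isStandardCW_standardCW w⟩, PresentationComplex.pathConnectedSpace,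
      PresentationComplex.nonempty_fundamentalGroup_mulEquiv hw⟩⟩
  obtain ⟨α, ι, w, ⟨i⟩, hw⟩ := exists_presents G
  obtain ⟨-, -, -, ⟨e₂, -⟩, h_no_cells, -⟩ := PresentationComplex.isStandardCW_standardCW w
  exact ⟨TopCat.of (PresentationComplex w), PresentationComplex.standardCW w,
    ⟨⟨e₂.symm i⟩, h_no_cells⟩, PresentationComplex.pathConnectedSpace,
    PresentationComplex.nonempty_fundamentalGroup_mulEquiv hw⟩
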